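/- **Problem.** Let $K\subseteq\mathbb R^n$ be nonempty, closed and convex. Consider $$\min_x\; f(x)+q(x)\quad\text{s.t.}\quad g(x)\le 0,\; h(x)=0,\; x\in K, \tag{P}$$ where $f$, $g=(g_1,\dots,g_m)$ and $h=(h_1,\dots,h_p)$ are $C^{1,1}$ (continuously differentiable with locally Lipschitz gradients) on an open set containing $K$, and $q$ is convex on $K$ and locally Lipschitz on an open set containing $K$. Put $\varphi(x)=\max_{i,j}\{g_i(x)_+,|h_j(x)|\}$ (a maximum over no indices is $0$); let $e$ be a vector of ones, $\mathbb B_\infty$ the closed unit ball of the infinity-norm, $N_C$ the normal cone to a convex set $C$, and $\partial q(x)$, for $x\in K$, the set of $v$ with $q(y)\ge q(x)+v^T(y-x)$ for all $y\in K$. (If $q$ is convex on an open set containing $K$, then $\partial q(x)+N_K(x)$ is the same with the ordinary convex subdifferential.) Let $$M_1(x)=\{(\xi,\pi): \xi\in N_{\mathbb R^m_-}(g(x)),\ \pi\in N_{\{0\}}(h(x)),\ 0\in\nabla f(x)+\partial q(x)+\nabla g(x)\xi+\nabla h(x)\pi+N_K(x)\},$$ $$M_0(x)=\{(\xi,\pi):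 \xi\in N_{\mathbb R^m_-}(g(x)-\varphi(x)e),\ \pi\in N_{\varphi(x)\mathbb B_\infty}(h(x)),\ 0\in\nabla g(x)\xi+\nabla h(x)\pi+N_K(x)\}.$$ A point $x\in K$ is a KKT point if $g(x)\le0$, $h(x)=0$ and $M_1(x)\ne\emptyset$; a Fritz-John point if $g(x)\le 0$, $h(x)=0$ and $M_0(x)\neq\{0\}$; an external stationary point if it violates $g\le0$ or $h=0$ and $M_0(x)\ne\{0\}$. It is generalized stationary if it is one of these. The extended Mangasarian-Fromovitz constraint qualification (eMFCQ) holds at $x\in K$ if $M_0(x)=\{0\}$. **Algorithm.** Fix $\beta>0$, $\rho\in(0,\beta)$, $\lambda\in(0,1)$, surrogates $\tilde f(d;x)$, $\tilde g_i(d;x)$, and put $\tilde h(d;x)=h(x)+\nabla h(x)^Td$. For $x\in K$ let $$\kappa(x)=(1-\lambda)\varphi(x)+\lambda\min_d\Big\{\max_{i,j}\{\tilde g_i(d;x)_+,|\tilde h_j(d;x)|\}: \|d\|_\infty\le\rho,\ d\in K-x\Big\},$$ and let $d(x)$ be the solution of $$\min_d\; \tilde f(d;x)+q(x+d)\quad\text{s.t.}\quad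 \tilde g(d;x)\le\kappa(x)e,\ -\kappa(x)e\le\tilde h(d;x)\le\kappa(x)e,\ \|d\|_\infty\le\beta,\ d\in K-x.$$ Given $x^0\in K$ and stepsizes $\gamma^\nu\in(0,1]$ with $\gamma^\nu\to0$ and $\sum_\nu\gamma^\nu=\infty$, the algorithm stops and returns $x^\nu$ if $x^\nu$ is generalized stationary, and otherwise sets $x^{\nu+1}=x^\nu+\gamma^\nu d(x^\nu)$. If it stops at $x^\nu$, the sequence is continued by the constant value $x^\nu$. **Assumption A.** There are open neighborhoods $O_d$ of $\beta\mathbb B_\infty$ and $O_x$ of $K$ such that $\tilde f(\cdot;x)$ and $\tilde g_i(\cdot;x)$ are continuously differentiable on $O_d$ for every $x\in O_x$; $\tilde f(\cdot;x)$ is strongly convex on $O_d$ for every $x\in K$, with a modulus $c>0$ independent of $x$; $\tilde g_i(\cdot;x)$ is convex on $O_d$ for every $x\in K$; $\tilde f$, $\nabla_1\tilde f$ and $\nabla_1\tilde g_i$ are continuous on $O_d\times O_x$, and $\tilde g_i$ is continuous on $\mathbb R^n\times O_x$; and, for every $x\in K$, $\nabla_1\tilde f(0;x)=\nabla f(x)$,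 $\tilde g_i(0;x)=g_i(x)$ and $\nabla_1\tilde g_i(0;x)=\nabla g_i(x)$. (Here $\nabla_1$ is the gradient with respect to the first argument.) **Assumption B.** For every compact $T\subseteq K$ there are $\mu,\alpha>0$ with $\|d(y)-d(z)\|\le\mu\|y-z\|^\alpha$ for all $y,z\in T$. **Corollary.** Let Assumption A hold and let the eMFCQ hold at every point of $K$. Then the whole sequence $\{x^\nu\}$ generated by the algorithm is contained in $K$, and either it is unbounded or the following assertions hold: (i) at least one limit point of $\{x^\nu\}$ is a KKT point of (P); (ii) if Assumption B also holds, then every limit point of $\{x^\nu\}$ is a KKT point of (P). -/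

import Mathlib

open Set Filter Topology

namespace GhostPenalty

/-- `ℝⁿ` with its Euclidean norm and inner product. -/
abbrev Vec (n : ℕ) : Type := EuclideanSpace ℝ (Fin n)

/-- The normal cone to a convex set `C` at `x` (empty when `x ∉ C`). -/
def normalCone {k : ℕ} (C : Set (Vec k)) (x : Vec k) : Set (Vec k) :=
  {v | x ∈ C ∧ ∀ y ∈ C, inner ℝ v (y - x) ≤ 0}

/-- The subdifferential at `x` of a function `q` that is convex on `C` (with `C` as its domain). -/
def subdifferential {k : ℕ} (C : Set (Vec k)) (q : Vec k → ℝ) (x : Vec k) : Set (Vec k) :=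
  {v | x ∈ C ∧ ∀ y ∈ C, q x + inner ℝ v (y - x) ≤ q y}

/-- If `q` is even convex on an open set `V ⊇ K`, then `∂q(x) + N_K(x)` with the ordinary
subdifferential (with respect to `V`, for instance all of `ℝᵏ`) is the subdifferential with respect
to `K`; so the stationarity conditions below do not depend on which of the two is used. -/
theorem mem_subdifferential_iff_of_convexOn_nhds {k : ℕ} {K V : Set (Vec k)} {q : Vec k → ℝ} {x v : Vec k}
    (hV : IsOpen V) (hKV : K ⊆ V) (hK : Convex ℝ K) (hq : ConvexOn ℝ V q) :
    v ∈ subdifferential K q x ↔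
      ∃ r ∈ subdifferential V q x, ∃ w ∈ normalCone K x, r + w = v := by
  constructor
  · rintro ⟨hx, h⟩
    set F : Vec k → ℝ := fun y => q y - q x - inner ℝ v (y - x) with hF
    have hqc : ContinuousOn q V := hq.continuousOn hV
    have hinn : ConcaveOn ℝ V (fun y => inner ℝ v (y - x)) := by
      refine ⟨hq.1, fun a _ b _ s t _ _ hst => ?_⟩
      have : s • a + t • b - x = s • (a - x) + t • (b - x) := by
        have : x = (s + t) • x := by simp [hst]
        nth_rewrite 1 [this]; module
      simp only [this, inner_add_right, inner_smul_right, smul_eq_mul, le_refl]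
    have hFc : ConvexOn ℝ V F := (hq.sub (concaveOn_const _ hq.1)).sub hinn
    have hFcont : ContinuousOn F V := (hqc.sub continuousOn_const).sub (by fun_prop)
    let A : Set (Vec k × ℝ) := {z | z.1 ∈ V ∧ F z.1 < z.2}
    let B : Set (Vec k × ℝ) := K ×ˢ Iic (0:ℝ)
    have hAo : IsOpen A := by
      have : ContinuousOn (fun z : Vec k × ℝ => F z.1 - z.2) (V ×ˢ univ) :=
        (hFcont.comp continuousOn_fst (fun z hz => hz.1)).sub continuousOn_snd
      have h2 := this.isOpen_inter_preimage (hV.prod isOpen_univ) (isOpen_Iio (a := (0:ℝ)))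
      convert h2 using 1
      ext z; simp [A]
    have hAc : Convex ℝ A := hFc.convex_strict_epigraph
    have hBc : Convex ℝ B := hK.prod (convex_Iic 0)
    have hdis : Disjoint A B := by
      rw [Set.disjoint_left]
      rintro ⟨y, t⟩ ⟨_, h1⟩ ⟨h2, h3⟩
      have := h y h2
      simp only [hF, mem_Iic] at h1 h3
      linarith
    obtain ⟨L, u, hA, hB⟩ := geometric_hahn_banach_open hAc hAo hBc hdis
    let s : ℝ := L (0, 1)
    let a : Vec k →L[ℝ] ℝ := L.comp (ContinuousLinearMap.inl ℝ (Vec k) ℝ)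
    have hL : ∀ y t, L (y, t) = a y + t * s := by
      intro y t
      have : ((y, t) : Vec k × ℝ) = (y, 0) + t • (0, 1) := by simp
      rw [this, map_add, map_smul]; simp [a, s]
    have hxF : F x = 0 := by simp [hF]
    have hs : s < 0 := by
      have h1 := hA (x, 1) ⟨hKV hx, by rw [hxF]; norm_num⟩
      have h2 := hB (x, 0) ⟨hx, by simp⟩
      rw [hL] at h1 h2; linarith
    have hux : u ≤ a x := by
      have h2 := hB (x, 0) ⟨hx, by simp⟩
      rw [hL] at h2; linarith
    have hAle : ∀ y ∈ V, a y + F y * s ≤ u := by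
      intro y hy
      refine le_of_forall_pos_le_add fun ε hε => ?_
      have := hA (y, F y + ε / (-s)) ⟨hy, by have : 0 < ε / (-s) := div_pos hε (by linarith)
                                             simp; linarith⟩
      rw [hL] at this
      have e : (F y + ε / (-s)) * s = F y * s - ε := by
        have hs0 : s ≠ 0 := hs.ne
        rw [add_mul, div_neg, neg_mul, div_mul_cancel₀ _ hs0]; ring
      linarith
    have hux' : u = a x := le_antisymm hux (by have := hAle x (hKV hx); rw [hxF] at this; linarith)
    let b : Vec k := (InnerProductSpace.toDual ℝ (Vec k)).symm a
    have hb : ∀ y, inner ℝ b y = a y := fun y => InnerProductSpace.toDual_symm_apply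
    refine ⟨v + (-s)⁻¹ • b, ⟨hKV hx, fun y hy => ?_⟩, -((-s)⁻¹ • b), ⟨hx, fun y hy => ?_⟩, by simp⟩
    · have h1 := hAle y hy
      rw [hux'] at h1
      simp only [inner_add_left, real_inner_smul_left, hb, map_sub]
      have : (-s)⁻¹ * (a y - a x) ≤ F y := by
        rw [inv_mul_le_iff₀ (by linarith)]; linarith
      simp only [hF] at this; linarith
    · have h2 := hB (y, 0) ⟨hy, by simp⟩
      rw [hL, hux'] at h2
      simp only [inner_neg_left, real_inner_smul_left, hb, map_sub]
      have : 0 ≤ (-s)⁻¹ * (a y - a x) := mul_nonneg (by rw [inv_nonneg]; linarith) (by linarith)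
      linarith
  · rintro ⟨r, ⟨_, hr⟩, w, ⟨hx, hw⟩, rfl⟩
    refine ⟨hx, fun y hy => ?_⟩
    have := hr y (hKV hy); have := hw y hy
    rw [inner_add_left]; linarith

/-- The nonpositive orthant `ℝᵏ₋`. -/
def nonposOrthant (k : ℕ) : Set (Vec k) := {y | ∀ i, y i ≤ 0}

/-- The closed ball `r 𝔹∞` of radius `r` around the origin, for the infinity-norm. -/
def infBall (k : ℕ) (r : ℝ) : Set (Vec k) := {y | ∀ i, |y i| ≤ r}

/-- `max_{i,j} {(u_i)₊, |w_j|}`; it is `0` when there are no indices at all. -/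
noncomputable def violation {m p : ℕ} (u : Fin m → ℝ) (w : Fin p → ℝ) : ℝ :=
  max (⨆ i, max 0 (u i)) (⨆ j, |w j|)

/-- `F` is `C^{1,1}` on an open set containing `K`: continuously differentiable there, with a
locally Lipschitz continuous derivative. -/
def C11Near {n : ℕ} (K : Set (Vec n)) (F : Vec n → ℝ) : Prop :=
  ∃ U : Set (Vec n), IsOpen U ∧ K ⊆ U ∧ ContDiffOn ℝ 1 F U ∧ LocallyLipschitzOn U (gradient F)

/-- The data of the problem: minimize `f x + q x` subject to `g x ≤ 0`, `h x = 0`, `x ∈ K`. -/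
structure Problem (n m p : ℕ) where
  K : Set (Vec n)
  f : Vec n → ℝ
  q : Vec n → ℝ
  g : Fin m → Vec n → ℝ
  h : Fin p → Vec n → ℝ

namespace Problem

variable {n m p : ℕ} (P : Problem n m p)

/-- The standing assumptions on the problem. -/
structure Standing : Prop where
  K_nonempty : P.K.Nonempty
  K_closed : IsClosed P.K
  K_convex : Convex ℝ P.K
  f_C11 : C11Near P.K P.f
  g_C11 : ∀ i, C11Near P.K (P.g i)
  h_C11 : ∀ j, C11Near P.K (P.h j)
  q_convex : ConvexOn ℝ P.K P.q
  q_lipschitz : ∃ U : Set (Vec n), IsOpen U ∧ P.K ⊆ U ∧ LocallyLipschitzOn U P.q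

/-- The infeasibility measure `φ`. -/
noncomputable def phi (x : Vec n) : ℝ := violation (fun i => P.g i x) (fun j => P.h j x)

/-- `∇g(x) ξ + ∇h(x) π`, with `∇g`, `∇h` the transposed Jacobians. -/
noncomputable def multGrad (x : Vec n) (ξ : Vec m) (π : Vec p) : Vec n :=
  ∑ i, ξ i • gradient (P.g i) x + ∑ j, π j • gradient (P.h j) x

/-- The set `M₁(x)` of KKT multipliers. -/
def M₁ (x : Vec n) : Set (Vec m × Vec p) :=
  {z | z.1 ∈ normalCone (nonposOrthant m) (WithLp.toLp 2 fun i => P.g i x) ∧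
    z.2 ∈ normalCone {0} (WithLp.toLp 2 fun j => P.h j x) ∧
    ∃ r ∈ subdifferential P.K P.q x, ∃ v ∈ normalCone P.K x,
      gradient P.f x + r + P.multGrad x z.1 z.2 + v = 0}

/-- The set `M₀(x)` of abnormal multipliers. -/
def M₀ (x : Vec n) : Set (Vec m × Vec p) :=
  {z | z.1 ∈ normalCone (nonposOrthant m) (WithLp.toLp 2 fun i => P.g i x - P.phi x) ∧
    z.2 ∈ normalCone (infBall p (P.phi x)) (WithLp.toLp 2 fun j => P.h j x) ∧
    ∃ v ∈ normalCone P.K x, P.multGrad x z.1 z.2 + v = 0}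

/-- `g x ≤ 0` and `h x = 0`. -/
def SatisfiesConstraints (x : Vec n) : Prop := (∀ i, P.g i x ≤ 0) ∧ ∀ j, P.h j x = 0

/-- KKT solutions. -/
def IsKKT (x : Vec n) : Prop := x ∈ P.K ∧ P.SatisfiesConstraints x ∧ (P.M₁ x).Nonempty

/-- Fritz-John solutions. -/
def IsFJ (x : Vec n) : Prop := x ∈ P.K ∧ P.SatisfiesConstraints x ∧ P.M₀ x ≠ {0}

/-- External stationary solutions. -/
def IsES (x : Vec n) : Prop :=
  x ∈ P.K ∧ ((∃ i, 0 < P.g i x) ∨ ∃ j, P.h j x ≠ 0) ∧ P.M₀ x ≠ {0}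

/-- Generalized stationary points. -/
def IsStationary (x : Vec n) : Prop := P.IsKKT x ∨ P.IsFJ x ∨ P.IsES x

/-- The extended Mangasarian-Fromovitz constraint qualification at `x`. -/
def EMFCQ (x : Vec n) : Prop := P.M₀ x = {0}

/-- `h̃(d; x) = h(x) + ∇h(x)ᵀ d`. -/
noncomputable def ht (j : Fin p) (d x : Vec n) : ℝ := P.h j x + inner ℝ (gradient (P.h j) x) d

end Problem

/-- The user's choices in the method: the surrogates `f̃(d; x)`, `g̃ᵢ(d; x)` (as functions of `d`
and then `x`) and the constants `β`, `ρ`, `λ`. -/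
structure Method (n m : ℕ) where
  ft : Vec n → Vec n → ℝ
  gt : Fin m → Vec n → Vec n → ℝ
  β : ℝ
  ρ : ℝ
  lam : ℝ

namespace Method

variable {n m p : ℕ} (S : Method n m) (P : Problem n m p)

/-- The ranges of the constants: `β > 0`, `ρ ∈ (0, β)`, `λ ∈ (0, 1)`. -/
structure Admissible : Prop where
  β_pos : 0 < S.β
  ρ_pos : 0 < S.ρ
  ρ_lt : S.ρ < S.β
  lam_pos : 0 < S.lam
  lam_lt : S.lam < 1

/-- The set `{d | ‖d‖∞ ≤ r, d ∈ K - x}`. -/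
def box (r : ℝ) (x : Vec n) : Set (Vec n) := {d | d ∈ infBall n r ∧ x + d ∈ P.K}

/-- `κ(x)`. The infimum is a minimum for continuous surrogates and `x ∈ K`. -/
noncomputable def kappa (x : Vec n) : ℝ :=
  (1 - S.lam) * P.phi x + S.lam *
    sInf ((fun d => violation (fun i => S.gt i d x) (fun j => P.ht j d x)) '' box P S.ρ x)

/-- The feasible set of the subproblem at `x`. -/
def feasible (x : Vec n) : Set (Vec n) :=
  {d | (∀ i, S.gt i d x ≤ S.kappa P x) ∧
    (∀ j, -S.kappa P x ≤ P.ht j d x ∧ P.ht j d x ≤ S.kappa P x) ∧ d ∈ box P S.β x}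

/-- `d` solves the subproblem at `x`: minimize `f̃(d; x) + q(x + d)` over its feasible set. -/
def IsSolution (x d : Vec n) : Prop :=
  d ∈ S.feasible P x ∧ ∀ e ∈ S.feasible P x, S.ft d x + P.q (x + d) ≤ S.ft e x + P.q (x + e)

/-- The direction `d(x)`: the solution of the subproblem at `x`. -/
noncomputable def dir (x : Vec n) : Vec n := Classical.epsilon (S.IsSolution P x)

/-- Assumption A, for given open neighborhoods `Od` of `β 𝔹∞` and `Ox` of `K`. -/
structure AssumptionAOn (Od Ox : Set (Vec n)) : Prop where
  Od_open : IsOpen Od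
  Ox_open : IsOpen Ox
  ball_subset : infBall n S.β ⊆ Od
  K_subset : P.K ⊆ Ox
  ft_diff : ∀ x ∈ Ox, ContDiffOn ℝ 1 (fun d => S.ft d x) Od
  gt_diff : ∀ i, ∀ x ∈ Ox, ContDiffOn ℝ 1 (fun d => S.gt i d x) Od
  A1 : ∃ c : ℝ, 0 < c ∧ ∀ x ∈ P.K, StrongConvexOn Od c (fun d => S.ft d x)
  A2 : ContinuousOn (fun z : Vec n × Vec n => S.ft z.1 z.2) (Od ×ˢ Ox)
  A3 : ContinuousOn (fun z : Vec n × Vec n => gradient (fun d => S.ft d z.2) z.1) (Od ×ˢ Ox)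
  A4 : ∀ x ∈ P.K, gradient (fun d => S.ft d x) 0 = gradient P.f x
  A5 : ∀ i, ∀ x ∈ P.K, ConvexOn ℝ Od (fun d => S.gt i d x)
  A6 : ∀ i, ContinuousOn (fun z : Vec n × Vec n => S.gt i z.1 z.2) (univ ×ˢ Ox)
  A7 : ∀ i, ∀ x ∈ P.K, S.gt i 0 x = P.g i x
  A8 : ∀ i, ContinuousOn (fun z : Vec n × Vec n => gradient (fun d => S.gt i d z.2) z.1) (Od ×ˢ Ox)
  A9 : ∀ i, ∀ x ∈ P.K, gradient (fun d => S.gt i d x) 0 = gradient (P.g i) x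

/-- Assumption A. -/
def AssumptionA : Prop := ∃ Od Ox : Set (Vec n), S.AssumptionAOn P Od Ox

/-- Assumption B: `d(·)` is Hölder continuous on the compact subsets of `K`. -/
def AssumptionB : Prop :=
  ∀ T : Set (Vec n), T ⊆ P.K → IsCompact T → ∃ μ α : ℝ, 0 < μ ∧ 0 < α ∧
    ∀ y ∈ T, ∀ z ∈ T, ‖S.dir P y - S.dir P z‖ ≤ μ * ‖y - z‖ ^ α

/-- Stepsizes: `γ^ν ∈ (0, 1]`, `γ^ν → 0`, `∑ γ^ν = ∞`. -/
structure IsStepsize (γ : ℕ → ℝ) : Prop where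
  pos : ∀ ν, 0 < γ ν
  le_one : ∀ ν, γ ν ≤ 1
  tendsto_zero : Tendsto γ atTop (𝓝 0)
  sum_infinite : Tendsto (fun N => ∑ ν ∈ Finset.range N, γ ν) atTop atTop

/-- `x` is the sequence generated by the algorithm from a point of `K` with stepsizes `γ`. A run
that stops and returns `x^ν` (at a generalized stationary point) is continued by the constant
value `x^ν`, whose only limit point is the returned point. -/
structure Generates (γ : ℕ → ℝ) (x : ℕ → Vec n) : Prop where
  start : x 0 ∈ P.K
  halt : ∀ ν, P.IsStationary (x ν) → x (ν + 1) = x ν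
  step : ∀ ν, ¬ P.IsStationary (x ν) → x (ν + 1) = x ν + γ ν • S.dir P (x ν)

end Method

end GhostPenalty

/-! The nonsmooth penalty function `merit a` = f + q + aφ is a Lyapunov function for the run. It
does not enter the algorithm; only the analysis needs a suitable weight a to exist.

Fritz John multipliers (w, ξ, π) of total mass 1 exist for every subproblem, by separation in finite
dimension (`exists_multipliers`). The key fact is that w ≥ ω > 0 uniformly on compact sets
(`exists_isMultiplier_ge`). Otherwise w tends to 0 along a convergent sequence of points. If the
limit is feasible, the limiting (ξ, π) is a nonzero element of M₀, against the eMFCQ. If it is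
infeasible, the eMFCQ makes `drop` bounded below nearby (`exists_le_drop`), so a point with
violation strictly below κ acts as a uniform Slater point and keeps w away from 0.

The bound on w shows that the model objective at d(x) exceeds its value at 0 by at most ω⁻¹λ·drop.
With a = ω⁻¹ this is exactly offset by the first order decrease of aφ, and strong convexity of f̃
leaves a decrease of order t‖d(x)‖², up to an error of order t²‖d(x)‖² (`exists_merit_descent`).
Since γ → 0, the series ∑ γ‖d‖² converges; since ∑ γ = ∞, the directions tend to 0 along a
subsequence.

Where directions tend to 0, limits are KKT points (`isKKT_of_tendsto`): feasibility follows from the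
uniform drop, and the multipliers can be divided by the limit of w. Under Assumption B, ‖d‖ is
uniformly continuous along the run, and a crossing argument (`tendsto_zero_of_summable_sq`) gives d
→ 0 for the whole sequence, so every limit point is covered. -/

namespace GhostPenalty

/-! ### Separation and Fritz John multipliers of convex systems -/

/-- In finite dimension, a point outside a nonempty convex set can be weakly separated from it. -/
theorem exists_ne_zero_nonneg_of_convex {E : Type*} [NormedAddCommGroup E] [NormedSpace ℝ E]
    [FiniteDimensional ℝ E] {C : Set E} (hC : Convex ℝ C) (hne : C.Nonempty) (h0 : (0 : E) ∉ C) :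
    ∃ f : E →ₗ[ℝ] ℝ, f ≠ 0 ∧ ∀ c ∈ C, 0 ≤ f c := by
  obtain ⟨c₀, hc₀⟩ := hne
  by_cases hint : (interior C).Nonempty
  · obtain ⟨f, hf, hle⟩ := geometric_hahn_banach_of_nonempty_interior_point hC
      (fun h => h0 (interior_subset h)) hint
    refine ⟨-f.toLinearMap, neg_ne_zero.2 fun h => hf ?_, fun c hc => ?_⟩
    · ext c
      exact LinearMap.congr_fun h c
    · have := hle c hc
      rw [map_zero] at this
      simpa using this
  -- With empty interior, `C` lies in a proper affine subspace, so some nonzero functional is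
  -- constant on `C`; its sign is free.
  · rw [hC.interior_nonempty_iff_affineSpan_eq_top,
      ← AffineSubspace.direction_eq_top_iff_of_nonempty ⟨c₀, subset_affineSpan ℝ C hc₀⟩] at hint
    obtain ⟨f, hf, hker⟩ := Submodule.exists_le_ker_of_lt_top _ (lt_top_iff_ne_top.2 hint)
    have hconst : ∀ c ∈ C, f c = f c₀ := fun c hc => by
      have : c - c₀ ∈ (affineSpan ℝ C).direction :=
        AffineSubspace.vsub_mem_direction (subset_affineSpan ℝ C hc) (subset_affineSpan ℝ C hc₀)
      have := hker this
      rw [LinearMap.mem_ker, map_sub] at this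
      linarith
    rcases le_total 0 (f c₀) with h | h
    · exact ⟨f, hf, fun c hc => by rw [hconst c hc]; exact h⟩
    · exact ⟨-f, neg_ne_zero.2 hf, fun c hc => by
        rw [LinearMap.neg_apply, hconst c hc]; linarith⟩

/-- Let `t → ∞`; in the primed version below, let `t → 0`. -/
theorem nonneg_of_forall_pos_add_mul {a b : ℝ} (h : ∀ t : ℝ, 0 < t → 0 ≤ a + t * b) : 0 ≤ b := by
  by_contra! hb
  have h1 := h ((|a| + 1) / (-b)) (div_pos (by positivity) (by linarith))
  have : (|a| + 1) / (-b) * b = -(|a| + 1) := by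
    rw [div_neg, neg_mul, div_mul_cancel₀ _ hb.ne]
  rw [this] at h1
  linarith [le_abs_self a]

theorem nonneg_of_forall_pos_add_mul' {a b : ℝ} (h : ∀ t : ℝ, 0 < t → 0 ≤ a + t * b) : 0 ≤ a := by
  by_contra! ha
  have h1 := h (-a / (2 * (|b| + 1))) (div_pos (by linarith) (by positivity))
  have h2 : -a / (2 * (|b| + 1)) * b ≤ -a / 2 := by
    rw [div_mul_eq_mul_div, div_le_div_iff₀ (by positivity) (by positivity)]
    nlinarith [le_abs_self b]
  linarith

/-- Multipliers of Fritz John type for a convex system without constraint qualification. -/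
theorem exists_multipliers {E : Type*} [AddCommGroup E] [Module ℝ E] {m p : ℕ} {D : Set E}
    (hD : Convex ℝ D) (hne : D.Nonempty) {F : E → ℝ} {G : Fin m → E → ℝ} {H : Fin p → E → ℝ}
    {J : Set ℝ} (hF : ConvexOn ℝ D F) (hG : ∀ i, ConvexOn ℝ D (G i))
    (hH : ∀ j, ∀ x ∈ D, ∀ y ∈ D, ∀ a b : ℝ, a + b = 1 →
      H j (a • x + b • y) = a * H j x + b * H j y)
    (hJ : Convex ℝ J) (hJne : J.Nonempty)
    (hno : ∀ d ∈ D, (∀ i, G i d < 0) → (∀ j, H j d ∈ J) → 0 ≤ F d) :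
    ∃ (w : ℝ) (ξ : Fin m → ℝ) (π : Fin p → ℝ), 0 ≤ w ∧ (∀ i, 0 ≤ ξ i) ∧
      w + ∑ i, ξ i + ∑ j, |π j| = 1 ∧ ∀ d ∈ D, ∀ r : Fin p → ℝ, (∀ j, r j ∈ J) →
        0 ≤ w * F d + ∑ i, ξ i * G i d + ∑ j, π j * (H j d - r j) := by
  obtain ⟨d₀, hd₀⟩ := hne
  obtain ⟨r₀, hr₀⟩ := hJne
  -- `C` collects all values strictly above those of `F` and `G`, with the third entry in `H d - J`.
  -- That it misses 0 is precisely `hno`.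
  let C : Set (ℝ × (Fin m → ℝ) × (Fin p → ℝ)) :=
    {z | ∃ d ∈ D, F d < z.1 ∧ (∀ i, G i d < z.2.1 i) ∧ ∀ j, H j d - z.2.2 j ∈ J}
  have hC : Convex ℝ C := by
    rintro z ⟨d, hd, h1, h2, h3⟩ z' ⟨d', hd', h1', h2', h3'⟩ a b ha hb hab
    have hlt : ∀ s t s' t' : ℝ, s < t → s' < t' → a * s + b * s' < a * t + b * t' := by
      intro s t s' t' hs hs'
      rcases ha.eq_or_lt with rfl | ha
      · obtain rfl : b = 1 := by linarith
        simpa using hs'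
      · exact add_lt_add_of_lt_of_le (mul_lt_mul_of_pos_left hs ha)
          (mul_le_mul_of_nonneg_left hs'.le hb)
    refine ⟨a • d + b • d', hD hd hd' ha hb hab, ?_, fun i => ?_, fun j => ?_⟩
    · exact (hF.2 hd hd' ha hb hab).trans_lt (by simpa using hlt _ _ _ _ h1 h1')
    · exact ((hG i).2 hd hd' ha hb hab).trans_lt (by simpa using hlt _ _ _ _ (h2 i) (h2' i))
    · have := hJ (h3 j) (h3' j) ha hb hab
      rw [hH j d hd d' hd' a b hab]
      convert this using 1
      simp only [Prod.snd_add, Prod.smul_snd, Pi.add_apply, Pi.smul_apply, smul_eq_mul]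
      ring
  have hmem : ∀ d ∈ D, ∀ r : Fin p → ℝ, (∀ j, r j ∈ J) → ∀ s : ℝ, ∀ t : Fin m → ℝ, 0 < s →
      (∀ i, 0 < t i) → (F d + s, fun i => G i d + t i, fun j => H j d - r j) ∈ C :=
    fun d hd r hr s t hs ht => ⟨d, hd, by simpa, by simpa, by simpa⟩
  obtain ⟨f, hf0, hf⟩ := exists_ne_zero_nonneg_of_convex hC
    ⟨_, hmem d₀ hd₀ (fun _ => r₀) (fun _ => hr₀) 1 (fun _ => 1) one_pos fun _ => one_pos⟩ (by
      rintro ⟨d, hd, h1, h2, h3⟩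
      simp only [Prod.fst_zero, Prod.snd_zero, Pi.zero_apply, sub_zero] at h1 h2 h3
      exact absurd (hno d hd h2 h3) (not_le.2 h1))
  let w := f (1, 0, 0)
  let ξ : Fin m → ℝ := fun i => f (0, Pi.single i 1, 0)
  let π : Fin p → ℝ := fun j => f (0, 0, Pi.single j 1)
  have hrep : ∀ z0 z1 z2, f (z0, z1, z2) = w * z0 + ∑ i, ξ i * z1 i + ∑ j, π j * z2 j := by
    intro z0 z1 z2
    have : (z0, z1, z2) = z0 • ((1 : ℝ), (0 : Fin m → ℝ), (0 : Fin p → ℝ)) +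
        ∑ i, z1 i • ((0 : ℝ), Pi.single i (1 : ℝ), (0 : Fin p → ℝ)) +
        ∑ j, z2 j • ((0 : ℝ), (0 : Fin m → ℝ), Pi.single j (1 : ℝ)) := by
      ext k <;> simp [Prod.fst_sum, Prod.snd_sum, Finset.sum_apply, Pi.single_apply]
    rw [this, map_add, map_add, map_sum, map_sum]
    simp only [map_smul, smul_eq_mul, w, ξ, π, mul_comm]
  -- `C` is unbounded upwards in the first two blocks, which forces the signs of `w` and `ξ`; `π`
  -- stays free.
  have hw : 0 ≤ w := by
    refine nonneg_of_forall_pos_add_mul (a := f (F d₀, fun i => G i d₀ + 1, fun j => H j d₀ - r₀))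
      fun t ht => ?_
    have := hf _ (hmem d₀ hd₀ (fun _ => r₀) (fun _ => hr₀) t (fun _ => 1) ht fun _ => one_pos)
    rw [hrep] at this ⊢
    linarith
  have hξ : ∀ i, 0 ≤ ξ i := by
    intro i
    refine nonneg_of_forall_pos_add_mul
      (a := f (F d₀ + 1, fun i => G i d₀ + 1, fun j => H j d₀ - r₀)) fun t ht => ?_
    have := hf _ (hmem d₀ hd₀ (fun _ => r₀) (fun _ => hr₀) 1
      (fun k => 1 + Pi.single (M := fun _ => ℝ) i t k) one_pos
      fun k => by
        by_cases hk : k = i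
        · subst hk; simp; linarith
        · simp [hk])
    rw [hrep] at this ⊢
    simp only [← add_assoc, mul_add, Finset.sum_add_distrib] at this ⊢
    simp only [Pi.single_apply, mul_ite, mul_zero, Finset.sum_ite_eq', Finset.mem_univ, if_true]
      at this
    linarith
  have hmain : ∀ d ∈ D, ∀ r : Fin p → ℝ, (∀ j, r j ∈ J) →
      0 ≤ w * F d + ∑ i, ξ i * G i d + ∑ j, π j * (H j d - r j) := by
    intro d hd r hr
    -- The strict slack `t` in the definition of `C` is sent to zero.
    refine nonneg_of_forall_pos_add_mul' (b := w + ∑ i, ξ i) fun t ht => ?_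
    have := hf _ (hmem d hd r hr t (fun _ => t) ht fun _ => ht)
    rw [hrep] at this
    simp only [mul_add, Finset.sum_add_distrib, ← Finset.sum_mul] at this
    linarith
  -- If the total mass vanished, the separating functional would be zero; so the mass can be
  -- normalized to 1.
  have hs : 0 < w + ∑ i, ξ i + ∑ j, |π j| := by
    have h1 : 0 ≤ ∑ i, ξ i := Finset.sum_nonneg fun i _ => hξ i
    have h2 : 0 ≤ ∑ j, |π j| := Finset.sum_nonneg fun i _ => abs_nonneg _
    refine lt_of_le_of_ne (by linarith) fun h => hf0 ?_
    have hw0 : w = 0 := by linarith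
    have hξ0 : ∀ i ∈ Finset.univ, ξ i = 0 :=
      (Finset.sum_eq_zero_iff_of_nonneg fun i _ => hξ i).1 (by linarith)
    have hπ0 : ∀ j ∈ Finset.univ, |π j| = 0 :=
      (Finset.sum_eq_zero_iff_of_nonneg fun i _ => abs_nonneg _).1 (by linarith)
    refine LinearMap.ext fun ⟨z0, z1, z2⟩ => ?_
    rw [hrep, hw0, Finset.sum_eq_zero fun i hi => by rw [hξ0 i hi, zero_mul],
      Finset.sum_eq_zero fun j hj => by rw [abs_eq_zero.1 (hπ0 j hj), zero_mul]]
    simp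
  set s := w + ∑ i, ξ i + ∑ j, |π j| with hsdef
  refine ⟨s⁻¹ * w, fun i => s⁻¹ * ξ i, fun j => s⁻¹ * π j, by positivity,
    fun i => mul_nonneg (by positivity) (hξ i), ?_, fun d hd r hr => ?_⟩
  · simp only [abs_mul, abs_of_pos (inv_pos.2 hs), ← Finset.mul_sum, ← mul_add]
    exact inv_mul_cancel₀ hs.ne'
  · have := mul_nonneg (inv_pos.2 hs).le (hmain d hd r hr)
    simpa only [mul_add, Finset.mul_sum, ← mul_assoc] using this

/-! One-sided directional information at the origin. -/

/-- Divide by `t` and let `t ↓ 0`. The constant `B` makes room for a nonsmooth convex term, whose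
increment over a step `t` is at most `t * B`. -/
theorem gradient_add_nonneg {k : ℕ} {F : Vec k → ℝ} {a d : Vec k} {B r : ℝ} (hr : 0 < r)
    (hF : HasGradientAt F a 0) (h : ∀ t : ℝ, 0 < t → t < r → 0 ≤ F (t • d) - F 0 + t * B) :
    0 ≤ inner ℝ a d + B := by
  have h1 : HasDerivAt (fun t : ℝ => F (t • d)) (inner ℝ a d) 0 := by
    have h2 : HasFDerivAt F (InnerProductSpace.toDual ℝ (Vec k) a) ((0 : ℝ) • d) := by
      rw [zero_smul]; exact hF.hasFDerivAt
    have h3 : HasDerivAt (fun t : ℝ => t • d) d 0 := by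
      simpa using (hasDerivAt_id (0 : ℝ)).smul_const d
    exact h2.comp_hasDerivAt (0 : ℝ) h3
  have h4 := h1.tendsto_slope_zero_right
  have h5 : Tendsto (fun t : ℝ => t⁻¹ • (F ((0 + t) • d) - F ((0 : ℝ) • d)) + B) (𝓝[>] 0)
      (𝓝 (inner ℝ a d + B)) := h4.add_const B
  refine ge_of_tendsto h5 ?_
  filter_upwards [Ioo_mem_nhdsGT hr] with t ht
  have := h t ht.1 ht.2
  have h6 := mul_nonneg (inv_pos.2 ht.1).le this
  rw [zero_add, zero_smul, smul_eq_mul]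
  rw [mul_add, inv_mul_cancel_left₀ ht.1.ne'] at h6
  exact h6

/-- The gradient inequality at the origin for (strongly) convex functions. -/
theorem inner_gradient_le {k : ℕ} {F : Vec k → ℝ} {a d : Vec k} {b : ℝ}
    (hF : HasGradientAt F a 0)
    (h : ∀ t : ℝ, 0 < t → t < 1 → F (t • d) ≤ (1 - t) * F 0 + t * F d - t * (1 - t) * b) :
    inner ℝ a d ≤ F d - F 0 - b := by
  refine le_of_forall_pos_le_add fun ε hε => ?_
  -- For `t` below this radius, `ε` absorbs the second order term `t² b`.
  have hr : 0 < min 1 (ε / (|b| + 1)) := lt_min one_pos (by positivity)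
  have hF' : HasGradientAt (fun y => -F y) (-a) 0 := by
    have := hF.hasFDerivAt.neg
    rw [hasGradientAt_iff_hasFDerivAt, map_neg]
    exact this
  have := gradient_add_nonneg (B := F d - F 0 - b + ε) (d := d) hr hF' fun t ht htr => by
    have h1 := h t ht (htr.trans_le (min_le_left _ _))
    have h2 : t * (|b| + 1) ≤ ε :=
      ((lt_div_iff₀ (by positivity)).1 (htr.trans_le (min_le_right _ _))).le
    have h3 : t * b ≤ t * (|b| + 1) :=
      mul_le_mul_of_nonneg_left (by linarith [le_abs_self b]) ht.le
    have h4 := mul_nonneg ht.le (sub_nonneg.2 (h3.trans h2))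
    nlinarith
  rw [inner_neg_left] at this
  linarith

/-! The violation measure and the cube. -/

theorem violation_nonneg {m p : ℕ} (u : Fin m → ℝ) (w : Fin p → ℝ) : 0 ≤ violation u w :=
  le_max_of_le_right (Real.iSup_nonneg fun _ => abs_nonneg _)

theorem violation_le_iff {m p : ℕ} {u : Fin m → ℝ} {w : Fin p → ℝ} {c : ℝ} (hc : 0 ≤ c) :
    violation u w ≤ c ↔ (∀ i, u i ≤ c) ∧ ∀ j, |w j| ≤ c := by
  constructor
  · intro h
    refine ⟨fun i => ?_, fun j => ?_⟩
    · exact (le_max_right 0 _).trans ((le_ciSup (f := fun i => max 0 (u i))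
        (Set.finite_range _).bddAbove i).trans ((le_max_left _ _).trans h))
    · exact (le_ciSup (f := fun j => |w j|) (Set.finite_range _).bddAbove j).trans
        ((le_max_right _ _).trans h)
  · rintro ⟨h1, h2⟩
    exact max_le (Real.iSup_le (fun i => max_le hc (h1 i)) hc) (Real.iSup_le h2 hc)

theorem le_violation {m p : ℕ} (u : Fin m → ℝ) (w : Fin p → ℝ) (i : Fin m) :
    u i ≤ violation u w := ((violation_le_iff (violation_nonneg u w)).1 le_rfl).1 i

theorem abs_le_violation {m p : ℕ} (u : Fin m → ℝ) (w : Fin p → ℝ) (j : Fin p) :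
    |w j| ≤ violation u w := ((violation_le_iff (violation_nonneg u w)).1 le_rfl).2 j

theorem violation_lt_of_forall_lt {m p : ℕ} {u : Fin m → ℝ} {w : Fin p → ℝ} {c : ℝ} (hc : 0 < c)
    (hu : ∀ i, u i < c) (hw : ∀ j, |w j| < c) : violation u w < c := by
  refine max_lt ?_ ?_
  · rcases isEmpty_or_nonempty (Fin m) with h | h
    · rwa [Real.iSup_of_isEmpty]
    · obtain ⟨i, hi⟩ := exists_eq_ciSup_of_finite (f := fun i => max 0 (u i))
      rw [← hi]; exact max_lt hc (hu i)
  · rcases isEmpty_or_nonempty (Fin p) with h | h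
    · rwa [Real.iSup_of_isEmpty]
    · obtain ⟨j, hj⟩ := exists_eq_ciSup_of_finite (f := fun j => |w j|)
      rw [← hj]; exact hw j

/-- Written as a norm on a product of sup-normed spaces, the violation is visibly continuous, with
empty index sets included. -/
theorem violation_eq_norm {m p : ℕ} (u : Fin m → ℝ) (w : Fin p → ℝ) :
    violation u w = ‖((fun i => max 0 (u i)), w)‖ := by
  refine le_antisymm ((violation_le_iff (norm_nonneg _)).2 ⟨fun i => ?_, fun j => ?_⟩) ?_
  · refine (le_max_right 0 _).trans ((le_abs_self _).trans ?_)
    exact (norm_le_pi_norm (fun i => max 0 (u i)) i).trans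
      (norm_fst_le ((fun i => max 0 (u i)), w))
  · exact (norm_le_pi_norm w j).trans (norm_snd_le ((fun i => max 0 (u i)), w))
  · rw [norm_prod_le_iff]
    constructor
    · refine (pi_norm_le_iff_of_nonneg (violation_nonneg u w)).2 fun i => ?_
      dsimp only
      rw [Real.norm_eq_abs, abs_of_nonneg (le_max_left _ _)]
      exact max_le (violation_nonneg u w) (le_violation u w i)
    · exact (pi_norm_le_iff_of_nonneg (violation_nonneg u w)).2 fun j => abs_le_violation u w j

theorem continuousOn_violation {X : Type*} [TopologicalSpace X] {m p : ℕ} {u : Fin m → X → ℝ}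
    {w : Fin p → X → ℝ} {s : Set X} (hu : ∀ i, ContinuousOn (u i) s)
    (hw : ∀ j, ContinuousOn (w j) s) :
    ContinuousOn (fun x => violation (fun i => u i x) (fun j => w j x)) s := by
  simp only [violation_eq_norm]
  exact ((continuousOn_pi.2 fun i => continuousOn_const.sup (hu i)).prodMk
    (continuousOn_pi.2 hw)).norm

theorem infBall_mono {k : ℕ} {r s : ℝ} (h : r ≤ s) : infBall k r ⊆ infBall k s :=
  fun _ hd i => (hd i).trans h

theorem zero_mem_infBall {k : ℕ} {r : ℝ} (h : 0 ≤ r) : (0 : Vec k) ∈ infBall k r :=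
  fun i => by simpa

theorem isCompact_infBall (k : ℕ) (r : ℝ) : IsCompact (infBall k r) := by
  have : infBall k r = (EuclideanSpace.equiv (Fin k) ℝ).toHomeomorph ⁻¹'
      (Set.pi univ fun _ => Icc (-r) r) := by
    ext y
    simp only [infBall, abs_le, mem_ofPred_eq, mem_preimage, mem_univ_pi, mem_Icc]
    rfl
  rw [this, Homeomorph.isCompact_preimage]
  exact isCompact_univ_pi fun _ => isCompact_Icc

theorem convex_infBall (k : ℕ) (r : ℝ) : Convex ℝ (infBall k r) := by
  intro x hx y hy a b ha hb hab i
  have h1 := abs_le.1 (hx i)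
  have h2 := abs_le.1 (hy i)
  refine abs_le.2 ⟨?_, ?_⟩ <;> simp only [PiLp.add_apply, PiLp.smul_apply, smul_eq_mul]
  · nlinarith [mul_le_mul_of_nonneg_left h1.1 ha, mul_le_mul_of_nonneg_left h2.1 hb]
  · nlinarith [mul_le_mul_of_nonneg_left h1.2 ha, mul_le_mul_of_nonneg_left h2.2 hb]

theorem abs_apply_le_norm {k : ℕ} (d : Vec k) (i : Fin k) : |d i| ≤ ‖d‖ :=
  PiLp.norm_apply_le d i

theorem exists_smul_mem_infBall {k : ℕ} (d : Vec k) {r : ℝ} (hr : 0 < r) :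
    ∃ r₀ : ℝ, 0 < r₀ ∧ r₀ ≤ 1 ∧ ∀ t : ℝ, 0 < t → t < r₀ → t • d ∈ infBall k r := by
  refine ⟨min 1 (r / (‖d‖ + 1)), lt_min one_pos (by positivity), min_le_left _ _,
    fun t ht htr i => ?_⟩
  have h1 : t * (‖d‖ + 1) < r := (lt_div_iff₀ (by positivity)).1 (htr.trans_le (min_le_right _ _))
  simp only [PiLp.smul_apply, smul_eq_mul, abs_mul, abs_of_pos ht]
  nlinarith [mul_le_mul_of_nonneg_left (abs_apply_le_norm d i) ht.le]

/-! ### First order expansion with quadratic remainder -/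

namespace C11Near

variable {n : ℕ} {K : Set (Vec n)} {F : Vec n → ℝ}

theorem hasGradientAt (h : C11Near K F) {x : Vec n} (hx : x ∈ K) :
    HasGradientAt F (gradient F x) x := by
  obtain ⟨U, hU, hKU, hF, -⟩ := h
  exact ((hF.differentiableOn one_ne_zero).differentiableAt (hU.mem_nhds (hKU hx))).hasGradientAt

theorem continuousOn (h : C11Near K F) : ContinuousOn F K :=
  fun _ hx => (h.hasGradientAt hx).continuousAt.continuousWithinAt

theorem locallyLipschitzOn_gradient (h : C11Near K F) : LocallyLipschitzOn K (gradient F) := by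
  obtain ⟨U, -, hKU, -, hF⟩ := h
  exact hF.mono hKU

theorem continuousOn_gradient (h : C11Near K F) : ContinuousOn (gradient F) K :=
  h.locallyLipschitzOn_gradient.continuousOn

/-- The descent lemma on compact convex subsets of `K`. -/
theorem exists_descent (h : C11Near K F) {T : Set (Vec n)} (hTK : T ⊆ K) (hT : IsCompact T)
    (hTc : Convex ℝ T) : ∃ L : ℝ, 0 ≤ L ∧ ∀ x ∈ T, ∀ y ∈ T,
      |F y - F x - inner ℝ (gradient F x) (y - x)| ≤ L * ‖y - x‖ ^ 2 := by
  obtain ⟨L, hL⟩ :=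
    (h.locallyLipschitzOn_gradient.mono hTK).exists_lipschitzOnWith_of_compact hT
  refine ⟨L, L.2, fun x hx y hy => ?_⟩
  have hseg : segment ℝ x y ⊆ T := hTc.segment_subset hx hy
  -- Mean value inequality for `F` minus its linear part at `x`: on the segment its derivative has
  -- norm at most `L * ‖y - x‖`.
  have hderiv : ∀ z ∈ segment ℝ x y,
      HasFDerivWithinAt (fun z => F z - inner ℝ (gradient F x) z)
        (InnerProductSpace.toDual ℝ (Vec n) (gradient F z - gradient F x)) (segment ℝ x y) z := by
    intro z hz
    have h1 := (h.hasGradientAt (hTK (hseg hz))).hasFDerivAt.hasFDerivWithinAt (s := segment ℝ x y)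
    have h2 := (InnerProductSpace.toDual ℝ (Vec n) (gradient F x)).hasFDerivWithinAt
      (s := segment ℝ x y) (x := z)
    rw [map_sub]
    exact h1.sub h2
  have hbound : ∀ z ∈ segment ℝ x y,
      ‖InnerProductSpace.toDual ℝ (Vec n) (gradient F z - gradient F x)‖ ≤ L * ‖y - x‖ := by
    intro z hz
    rw [LinearIsometryEquiv.norm_map]
    refine (hL.norm_sub_le (hseg hz) hx).trans (mul_le_mul_of_nonneg_left ?_ L.2)
    obtain ⟨a, b, ha, hb, hab, rfl⟩ := hz
    have : a • x + b • y - x = b • (y - x) := by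
      obtain rfl : a = 1 - b := by linarith
      module
    rw [this, norm_smul, Real.norm_of_nonneg hb]
    exact mul_le_of_le_one_left (norm_nonneg _) (by linarith)
  have := (convex_segment x y).norm_image_sub_le_of_norm_hasFDerivWithin_le hderiv hbound
    (left_mem_segment ℝ x y) (right_mem_segment ℝ x y)
  rw [Real.norm_eq_abs] at this
  convert this using 1
  · rw [inner_sub_right]; congr 1; ring
  · ring

end C11Near

/-! ### Auxiliary quantities of the subproblem -/

namespace Method

variable {n m p : ℕ} (S : Method n m) (P : Problem n m p)

/-- The violation of the model constraints at `x` in the direction `d`. -/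
noncomputable def modelViolation (d x : Vec n) : ℝ :=
  violation (fun i => S.gt i d x) (fun j => P.ht j d x)

/-- The objective of the subproblem. -/
noncomputable def obj (d x : Vec n) : ℝ := S.ft d x + P.q (x + d)

/-- The constraint part of the Lagrangian of the subproblem at level `κ`. -/
noncomputable def lagr (ξ : Fin m → ℝ) (π : Fin p → ℝ) (κ : ℝ) (d x : Vec n) : ℝ :=
  ∑ i, ξ i * (S.gt i d x - κ) + ∑ j, (π j * P.ht j d x - |π j| * κ)

/-- The pairs (direction, point) on which the subproblems live. -/
def graph : Set (Vec n × Vec n) := {z | z.2 ∈ P.K ∧ z.1 ∈ box P S.β z.2}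

/-- The decrease of the model violation that is possible within the small box. -/
noncomputable def drop (x : Vec n) : ℝ :=
  P.phi x - sInf ((fun d => S.modelViolation P d x) '' box P S.ρ x)

end Method

variable {n m p : ℕ} {P : Problem n m p} {S : Method n m} {Od Ox : Set (Vec n)}

/-! ### Penalty function and elementary facts on the constraints -/

namespace Problem

/-- The nonsmooth exact penalty function. -/
noncomputable def merit (P : Problem n m p) (a : ℝ) (x : Vec n) : ℝ :=
  P.f x + P.q x + a * P.phi x

theorem continuousOn_phi (hP : P.Standing) : ContinuousOn P.phi P.K :=
  continuousOn_violation (fun i => (hP.g_C11 i).continuousOn) fun j => (hP.h_C11 j).continuousOn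

theorem phi_nonneg (x : Vec n) : 0 ≤ P.phi x := violation_nonneg _ _

theorem g_le_phi (i : Fin m) (x : Vec n) : P.g i x ≤ P.phi x :=
  le_violation (fun i => P.g i x) _ i

theorem abs_h_le_phi (j : Fin p) (x : Vec n) : |P.h j x| ≤ P.phi x :=
  abs_le_violation _ (fun j => P.h j x) j

theorem continuousOn_q (hP : P.Standing) : ContinuousOn P.q P.K := by
  obtain ⟨U, -, hKU, hq⟩ := hP.q_lipschitz
  exact hq.continuousOn.mono hKU

theorem satisfiesConstraints_iff_phi_eq_zero {x : Vec n} :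
    P.SatisfiesConstraints x ↔ P.phi x = 0 := by
  rw [← (phi_nonneg (P := P) x).ge_iff_eq', phi, violation_le_iff le_rfl]
  simp [SatisfiesConstraints]

theorem continuousOn_ht (hP : P.Standing) (j : Fin p) :
    ContinuousOn (fun z : Vec n × Vec n => P.ht j z.1 z.2) (univ ×ˢ P.K) :=
  ((hP.h_C11 j).continuousOn.comp continuousOn_snd fun _ hz => hz.2).add
    (ContinuousOn.inner ((hP.h_C11 j).continuousOn_gradient.comp continuousOn_snd
      fun _ hz => hz.2) continuousOn_fst)

theorem ht_zero (j : Fin p) (x : Vec n) : P.ht j 0 x = P.h j x := by simp [ht]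

theorem ht_affine (j : Fin p) (x d e : Vec n) {a b : ℝ} (hab : a + b = 1) :
    P.ht j (a • d + b • e) x = a * P.ht j d x + b * P.ht j e x := by
  simp only [ht, inner_add_right, inner_smul_right]
  linear_combination -(P.h j x) * hab

end Problem

/-! ### Well-posedness and convexity of the subproblem -/

namespace Method

theorem zero_mem_box {r : ℝ} (hr : 0 ≤ r) {x : Vec n} (hx : x ∈ P.K) : (0 : Vec n) ∈ box P r x :=
  ⟨zero_mem_infBall hr, by simpa⟩

theorem box_mono {r s : ℝ} (h : r ≤ s) (x : Vec n) : box P r x ⊆ box P s x :=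
  fun _ hd => ⟨infBall_mono h hd.1, hd.2⟩

theorem convex_box (hP : P.Standing) (r : ℝ) (x : Vec n) : Convex ℝ (box P r x) := by
  intro d hd e he a b ha hb hab
  refine ⟨convex_infBall n r hd.1 he.1 ha hb hab, ?_⟩
  have := hP.K_convex hd.2 he.2 ha hb hab
  convert this using 1
  obtain rfl : a = 1 - b := by linarith
  module

theorem smul_mem_box (hP : P.Standing) {r : ℝ} (hr : 0 ≤ r) {x d : Vec n} (hx : x ∈ P.K)
    (hd : d ∈ box P r x) {t : ℝ} (ht : 0 ≤ t) (ht1 : t ≤ 1) : t • d ∈ box P r x := by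
  have := convex_box hP r x hd (zero_mem_box hr hx) ht (sub_nonneg.2 ht1) (by ring)
  simpa using this

theorem isCompact_box (hP : P.Standing) (r : ℝ) (x : Vec n) : IsCompact (box P r x) :=
  (isCompact_infBall n r).inter_right (hP.K_closed.preimage (by fun_prop))

theorem continuousOn_gt (hA : S.AssumptionAOn P Od Ox) (i : Fin m) :
    ContinuousOn (fun z : Vec n × Vec n => S.gt i z.1 z.2) (univ ×ˢ P.K) :=
  (hA.A6 i).mono (prod_mono_right hA.K_subset)

theorem continuousOn_modelViolation (hP : P.Standing) (hA : S.AssumptionAOn P Od Ox) :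
    ContinuousOn (fun z : Vec n × Vec n => S.modelViolation P z.1 z.2) (univ ×ˢ P.K) :=
  continuousOn_violation (fun i => continuousOn_gt hA i) fun j => P.continuousOn_ht hP j

theorem gt_le_modelViolation (i : Fin m) (d x : Vec n) : S.gt i d x ≤ S.modelViolation P d x :=
  le_violation (fun i => S.gt i d x) _ i

theorem abs_ht_le_modelViolation (j : Fin p) (d x : Vec n) :
    |P.ht j d x| ≤ S.modelViolation P d x :=
  abs_le_violation _ (fun j => P.ht j d x) j

theorem modelViolation_zero (hA : S.AssumptionAOn P Od Ox) {x : Vec n} (hx : x ∈ P.K) :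
    S.modelViolation P 0 x = P.phi x := by
  simp only [modelViolation, Problem.phi, hA.A7 _ x hx, Problem.ht_zero]

theorem continuousOn_fst_slice {f : Vec n × Vec n → ℝ} {s : Set (Vec n)}
    (hf : ContinuousOn f (univ ×ˢ s)) {x : Vec n} (hx : x ∈ s) :
    Continuous fun d => f (d, x) :=
  continuousOn_univ.1 (hf.comp (by fun_prop) fun _ _ => ⟨trivial, hx⟩)

theorem exists_isMinOn_modelViolation (hP : P.Standing) (hS : S.Admissible)
    (hA : S.AssumptionAOn P Od Ox) {x : Vec n} (hx : x ∈ P.K) :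
    ∃ d ∈ box P S.ρ x, S.modelViolation P d x = P.phi x - S.drop P x := by
  obtain ⟨d, hd, hmin⟩ := (isCompact_box hP S.ρ x).exists_sInf_image_eq
    ⟨0, zero_mem_box hS.ρ_pos.le hx⟩
    (continuousOn_fst_slice (continuousOn_modelViolation hP hA) hx).continuousOn
  refine ⟨d, hd, ?_⟩
  rw [drop, hmin]
  ring

theorem sub_modelViolation_le_drop {x d : Vec n} (hd : d ∈ box P S.ρ x) :
    P.phi x - S.modelViolation P d x ≤ S.drop P x := by
  have : sInf ((fun d => S.modelViolation P d x) '' box P S.ρ x) ≤ S.modelViolation P d x :=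
    csInf_le ⟨0, by rintro _ ⟨e, -, rfl⟩; exact violation_nonneg _ _⟩ ⟨d, hd, rfl⟩
  rw [drop]
  linarith

theorem drop_nonneg (hS : S.Admissible) (hA : S.AssumptionAOn P Od Ox) {x : Vec n}
    (hx : x ∈ P.K) : 0 ≤ S.drop P x := by
  have := sub_modelViolation_le_drop (zero_mem_box hS.ρ_pos.le hx)
  rwa [modelViolation_zero hA hx, sub_self] at this

/-- This form, relaxing the constraints to a fraction `λ` of the attainable decrease, is the one
used throughout. -/
theorem kappa_eq (x : Vec n) : S.kappa P x = P.phi x - S.lam * S.drop P x := by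
  rw [kappa, drop]
  simp only [modelViolation]
  ring

theorem kappa_nonneg (hP : P.Standing) (hS : S.Admissible) (hA : S.AssumptionAOn P Od Ox)
    {x : Vec n} (hx : x ∈ P.K) : 0 ≤ S.kappa P x := by
  obtain ⟨d, -, hd⟩ := exists_isMinOn_modelViolation hP hS hA hx
  have h1 : 0 ≤ S.modelViolation P d x := violation_nonneg _ _
  have h2 := drop_nonneg hS hA hx
  rw [kappa_eq]
  nlinarith [hS.lam_lt]

theorem kappa_le_phi (hS : S.Admissible) (hA : S.AssumptionAOn P Od Ox)
    {x : Vec n} (hx : x ∈ P.K) : S.kappa P x ≤ P.phi x := by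
  rw [kappa_eq]
  linarith [mul_nonneg hS.lam_pos.le (drop_nonneg hS hA hx)]

/-- The violation is clipped at 0, so the equivalence rests on `κ ≥ 0`. -/
theorem mem_feasible_iff (hP : P.Standing) (hS : S.Admissible) (hA : S.AssumptionAOn P Od Ox)
    {x d : Vec n} (hx : x ∈ P.K) :
    d ∈ S.feasible P x ↔ S.modelViolation P d x ≤ S.kappa P x ∧ d ∈ box P S.β x := by
  rw [modelViolation, violation_le_iff (kappa_nonneg hP hS hA hx)]
  simp only [feasible, mem_ofPred_eq, abs_le, and_assoc]

theorem continuousOn_obj (hP : P.Standing) (hA : S.AssumptionAOn P Od Ox) :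
    ContinuousOn (fun z : Vec n × Vec n => S.obj P z.1 z.2) (S.graph P) := by
  refine (hA.A2.mono fun z hz => ⟨hA.ball_subset hz.2.1, hA.K_subset hz.1⟩).add ?_
  exact (P.continuousOn_q hP).comp (by fun_prop) fun z hz => hz.2.2

theorem exists_isSolution (hP : P.Standing) (hS : S.Admissible) (hA : S.AssumptionAOn P Od Ox)
    {x : Vec n} (hx : x ∈ P.K) : ∃ d, S.IsSolution P x d := by
  have hset : S.feasible P x = box P S.β x ∩ {d | S.modelViolation P d x ≤ S.kappa P x} := by
    ext d
    rw [mem_feasible_iff hP hS hA hx, and_comm]; rfl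
  have hcomp : IsCompact (S.feasible P x) := by
    rw [hset]
    exact (isCompact_box hP S.β x).inter_right (isClosed_le
      (continuousOn_fst_slice (continuousOn_modelViolation hP hA) hx) continuous_const)
  have hne : (S.feasible P x).Nonempty := by
    -- The minimizer of the violation in the small box has violation φ - drop ≤ φ - λ·drop = κ, so
    -- it is feasible.
    obtain ⟨d, hd, hd'⟩ := exists_isMinOn_modelViolation hP hS hA hx
    refine ⟨d, (mem_feasible_iff hP hS hA hx).2 ⟨?_, box_mono hS.ρ_lt.le x hd⟩⟩
    rw [hd', kappa_eq]
    nlinarith [drop_nonneg hS hA hx, hS.lam_lt]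
  have hcont : ContinuousOn (fun d => S.obj P d x) (S.feasible P x) :=
    (continuousOn_obj hP hA).comp (f := fun d => (d, x)) (by fun_prop)
      fun d hd => ⟨hx, ((mem_feasible_iff hP hS hA hx).1 hd).2⟩
  obtain ⟨d, hd, hmin⟩ := hcomp.exists_isMinOn hne hcont
  exact ⟨d, hd, fun e he => hmin he⟩

theorem isSolution_dir (hP : P.Standing) (hS : S.Admissible) (hA : S.AssumptionAOn P Od Ox)
    {x : Vec n} (hx : x ∈ P.K) : S.IsSolution P x (S.dir P x) :=
  Classical.epsilon_spec (exists_isSolution hP hS hA hx)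

theorem dir_mem_box (hP : P.Standing) (hS : S.Admissible) (hA : S.AssumptionAOn P Od Ox)
    {x : Vec n} (hx : x ∈ P.K) : S.dir P x ∈ box P S.β x :=
  ((mem_feasible_iff hP hS hA hx).1 (isSolution_dir hP hS hA hx).1).2

theorem modelViolation_dir_le (hP : P.Standing) (hS : S.Admissible)
    (hA : S.AssumptionAOn P Od Ox) {x : Vec n} (hx : x ∈ P.K) :
    S.modelViolation P (S.dir P x) x ≤ S.kappa P x :=
  ((mem_feasible_iff hP hS hA hx).1 (isSolution_dir hP hS hA hx).1).1

theorem obj_dir_le (hP : P.Standing) (hS : S.Admissible) (hA : S.AssumptionAOn P Od Ox)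
    {x d : Vec n} (hx : x ∈ P.K) (hd : d ∈ box P S.β x)
    (hv : S.modelViolation P d x ≤ S.kappa P x) : S.obj P (S.dir P x) x ≤ S.obj P d x :=
  (isSolution_dir hP hS hA hx).2 d ((mem_feasible_iff hP hS hA hx).2 ⟨hv, hd⟩)

theorem convexOn_obj (hP : P.Standing) (hA : S.AssumptionAOn P Od Ox) {x : Vec n}
    (hx : x ∈ P.K) : ConvexOn ℝ (box P S.β x) fun d => S.obj P d x := by
  obtain ⟨c, hc, hsc⟩ := hA.A1
  refine ConvexOn.add (((hsc x hx).convexOn fun r => by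
    simp only [Pi.zero_apply]; positivity).subset
    (fun d hd => hA.ball_subset hd.1) (convex_box hP S.β x)) ⟨convex_box hP S.β x, ?_⟩
  intro d hd e he a b ha hb hab
  have := hP.q_convex.2 hd.2 he.2 ha hb hab
  convert this using 2
  obtain rfl : a = 1 - b := by linarith
  module

theorem convexOn_gt (hP : P.Standing) (hA : S.AssumptionAOn P Od Ox) {x : Vec n}
    (hx : x ∈ P.K) {r : ℝ} (hr : r ≤ S.β) (i : Fin m) :
    ConvexOn ℝ (box P r x) fun d => S.gt i d x :=
  (hA.A5 i x hx).subset (fun _ hd => hA.ball_subset (infBall_mono hr hd.1)) (convex_box hP r x)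

theorem zero_mem_Od (hS : S.Admissible) (hA : S.AssumptionAOn P Od Ox) : (0 : Vec n) ∈ Od :=
  hA.ball_subset (zero_mem_infBall hS.β_pos.le)

theorem hasGradientAt_ft (hS : S.Admissible) (hA : S.AssumptionAOn P Od Ox) {x : Vec n}
    (hx : x ∈ P.K) : HasGradientAt (fun d => S.ft d x) (gradient P.f x) 0 := by
  rw [← hA.A4 x hx]
  exact (((hA.ft_diff x (hA.K_subset hx)).differentiableOn one_ne_zero).differentiableAt
    (hA.Od_open.mem_nhds (zero_mem_Od hS hA))).hasGradientAt

theorem hasGradientAt_gt (hS : S.Admissible) (hA : S.AssumptionAOn P Od Ox) {x : Vec n}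
    (hx : x ∈ P.K) (i : Fin m) :
    HasGradientAt (fun d => S.gt i d x) (gradient (P.g i) x) 0 := by
  rw [← hA.A9 i x hx]
  exact (((hA.gt_diff i x (hA.K_subset hx)).differentiableOn one_ne_zero).differentiableAt
    (hA.Od_open.mem_nhds (zero_mem_Od hS hA))).hasGradientAt

theorem hasGradientAt_ht (j : Fin p) (x : Vec n) :
    HasGradientAt (fun d => P.ht j d x) (gradient (P.h j) x) 0 := by
  rw [hasGradientAt_iff_hasFDerivAt]
  exact (InnerProductSpace.toDual ℝ (Vec n) (gradient (P.h j) x)).hasFDerivAt.const_add _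

theorem hasGradientAt_lagr (hS : S.Admissible) (hA : S.AssumptionAOn P Od Ox) {x : Vec n}
    (hx : x ∈ P.K) (w : ℝ) (ξ : Fin m → ℝ) (π : Fin p → ℝ) (κ : ℝ) :
    HasGradientAt (fun d => w * S.ft d x + S.lagr P ξ π κ d x)
      (w • gradient P.f x + P.multGrad x (WithLp.toLp 2 ξ) (WithLp.toLp 2 π)) 0 := by
  rw [hasGradientAt_iff_hasFDerivAt, Problem.multGrad]
  simp only [map_add, map_sum, map_smul]
  refine ((hasGradientAt_ft hS hA hx).hasFDerivAt.const_mul w).add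
    ((HasFDerivAt.fun_sum fun i _ => ?_).add (HasFDerivAt.fun_sum fun j _ => ?_))
  · exact ((hasGradientAt_gt hS hA hx i).hasFDerivAt.sub_const κ).const_mul (ξ i)
  · exact ((hasGradientAt_ht j x).hasFDerivAt.const_mul (π j)).sub_const _

end Method

/-! ### Abnormal multipliers and decrease of the violation -/

theorem inner_toLp_toLp_sub {k : ℕ} (v u : Fin k → ℝ) (y : Vec k) :
    inner ℝ (WithLp.toLp 2 v) (y - WithLp.toLp 2 u) = ∑ i, v i * (y i - u i) := by
  simp [PiLp.inner_apply, mul_comm]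

namespace Method

theorem lagr_zero (hA : S.AssumptionAOn P Od Ox) {x : Vec n} (hx : x ∈ P.K) (ξ : Fin m → ℝ)
    (π : Fin p → ℝ) (κ : ℝ) : S.lagr P ξ π κ 0 x =
      ∑ i, ξ i * (P.g i x - κ) + ∑ j, (π j * P.h j x - |π j| * κ) := by
  simp only [lagr, hA.A7 _ x hx, Problem.ht_zero]

/-- Nonnegativity of the Lagrangian at the origin forces complementarity. -/
theorem complementarity (hA : S.AssumptionAOn P Od Ox) {x : Vec n} (hx : x ∈ P.K)
    {ξ : Fin m → ℝ} {π : Fin p → ℝ} (hξ : ∀ i, 0 ≤ ξ i)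
    (h : 0 ≤ S.lagr P ξ π (P.phi x) 0 x) :
    (∀ i, ξ i * (P.g i x - P.phi x) = 0) ∧ (∀ j, π j * P.h j x - |π j| * P.phi x = 0) ∧
      S.lagr P ξ π (P.phi x) 0 x = 0 := by
  have h1 : ∀ i ∈ Finset.univ, ξ i * (P.g i x - P.phi x) ≤ 0 := fun i _ =>
    mul_nonpos_of_nonneg_of_nonpos (hξ i) (sub_nonpos.2 (P.g_le_phi i x))
  have h2 : ∀ j ∈ Finset.univ, π j * P.h j x - |π j| * P.phi x ≤ 0 := fun j _ => by
    have := mul_le_mul_of_nonneg_left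
      (P.abs_h_le_phi j x) (abs_nonneg (π j))
    rw [← abs_mul] at this
    exact sub_nonpos.2 ((le_abs_self _).trans this)
  rw [lagr_zero hA hx] at h ⊢
  have h3 := Finset.sum_nonpos h1
  have h4 := Finset.sum_nonpos h2
  refine ⟨fun i => (Finset.sum_eq_zero_iff_of_nonpos h1).1 (by linarith) i (Finset.mem_univ i),
    fun j => (Finset.sum_eq_zero_iff_of_nonpos h2).1 (by linarith) j (Finset.mem_univ j),
    by linarith⟩

theorem toLp_mem_normalCone_nonposOrthant {x : Vec n} {ξ : Fin m → ℝ} (hξ : ∀ i, 0 ≤ ξ i)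
    (h : ∀ i, ξ i * (P.g i x - P.phi x) = 0) :
    WithLp.toLp 2 ξ ∈ normalCone (nonposOrthant m) (WithLp.toLp 2 fun i => P.g i x - P.phi x) := by
  refine ⟨fun i => sub_nonpos.2 (P.g_le_phi i x), fun y hy => ?_⟩
  rw [inner_toLp_toLp_sub]
  refine Finset.sum_nonpos fun i _ => ?_
  rw [mul_sub, h i, sub_zero]
  exact mul_nonpos_of_nonneg_of_nonpos (hξ i) (hy i)

/-- A criterion for abnormal multipliers in terms of the model constraints. -/
theorem toLp_mem_M₀ (hP : P.Standing) (hS : S.Admissible) (hA : S.AssumptionAOn P Od Ox)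
    {x : Vec n} (hx : x ∈ P.K) {ξ : Fin m → ℝ} {π : Fin p → ℝ} (hξ : ∀ i, 0 ≤ ξ i) {r : ℝ}
    (hr : 0 < r) (h : ∀ d ∈ box P r x, 0 ≤ S.lagr P ξ π (P.phi x) d x) :
    ((WithLp.toLp 2 ξ, WithLp.toLp 2 π) : Vec m × Vec p) ∈ P.M₀ x := by
  obtain ⟨h1, h2, h0⟩ := complementarity hA hx hξ (h 0 (zero_mem_box hr.le hx))
  refine ⟨toLp_mem_normalCone_nonposOrthant hξ h1,
    ⟨fun j => P.abs_h_le_phi j x, fun y hy => ?_⟩,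
    -P.multGrad x (WithLp.toLp 2 ξ) (WithLp.toLp 2 π), ⟨hx, fun y hy => ?_⟩, add_neg_cancel _⟩
  · dsimp only
    rw [inner_toLp_toLp_sub]
    refine Finset.sum_nonpos fun j _ => ?_
    have h3 := mul_le_mul_of_nonneg_left (hy j) (abs_nonneg (π j))
    rw [← abs_mul] at h3
    have h4 := le_abs_self (π j * y j)
    rw [mul_sub]
    linarith [h2 j]
  -- The Lagrangian vanishes at 0 and is nonnegative on the box, which contains short multiples of
  -- `y - x`; hence its slope towards `y` is nonnegative.
  · obtain ⟨r₀, hr₀, hr₁, hsm⟩ := exists_smul_mem_infBall (y - x) hr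
    have hg := hasGradientAt_lagr hS hA hx 0 ξ π (P.phi x)
    have := gradient_add_nonneg (d := y - x) (B := 0) hr₀ hg fun t ht htr => by
      have h3 := h (t • (y - x)) ⟨hsm t ht htr,
        hP.K_convex.add_smul_sub_mem hx hy ⟨ht.le, htr.le.trans hr₁⟩⟩
      rw [h0]
      linarith
    rw [zero_smul, zero_add, add_zero] at this
    rw [inner_neg_left]
    linarith

/-- Under the extended constraint qualification, infeasible points admit a direction that
decreases the model violation. -/
theorem exists_modelViolation_lt_phi (hP : P.Standing) (hS : S.Admissible)
    (hA : S.AssumptionAOn P Od Ox) {x : Vec n} (hx : x ∈ P.K) (hCQ : P.EMFCQ x)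
    (hφ : 0 < P.phi x) : ∃ d ∈ box P S.ρ x, S.modelViolation P d x < P.phi x := by
  by_contra! hcon
  -- With the objective -1, the hypothesis `hno` says that the strict system has no solution, which
  -- is what `hcon` provides.
  obtain ⟨w, ξ, π, hw, hξ, hsum, hmain⟩ := exists_multipliers (convex_box hP S.ρ x)
    ⟨0, zero_mem_box hS.ρ_pos.le hx⟩ (F := fun _ => -1) (G := fun i d => S.gt i d x - P.phi x)
    (H := fun j d => P.ht j d x) (J := Ioo (-P.phi x) (P.phi x))
    (convexOn_const _ (convex_box hP S.ρ x))
    (fun i => (convexOn_gt hP hA hx hS.ρ_lt.le i).sub (concaveOn_const _ (convex_box hP S.ρ x)))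
    (fun j d _ e _ a b hab => P.ht_affine j x d e hab) (convex_Ioo _ _)
    ⟨0, by simpa using hφ⟩
    (fun d hd h1 h2 => absurd (violation_lt_of_forall_lt hφ (fun i => sub_neg.1 (h1 i))
      fun j => abs_lt.2 (h2 j)) (not_lt.2 (hcon d hd)))
  have hlag : ∀ d ∈ box P S.ρ x, w ≤ S.lagr P ξ π (P.phi x) d x := by
    intro d hd
    have hB : 0 ≤ ∑ j, |π j| * P.phi x := Finset.sum_nonneg fun j _ => by positivity
    have hle1 : ∀ t : ℝ, 0 < t → t ≤ 1 →
        0 ≤ (S.lagr P ξ π (P.phi x) d x - w) + t * ∑ j, |π j| * P.phi x := by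
      intro t ht ht1
      -- The open interval excludes the endpoint `φ * sign π`, so it is approached by the factor `1
      -- - t`; in the limit π contributes the support term |π|φ.
      have := hmain d hd (fun j => (1 - t) * P.phi x * SignType.sign (π j)) fun j => by
        rw [mem_Ioo, ← abs_lt]
        have h1 : |((SignType.sign (π j) : SignType) : ℝ)| ≤ 1 := by
          rcases SignType.sign (π j) with _ | _ | _ <;> simp
        rw [abs_mul, abs_of_nonneg (mul_nonneg (sub_nonneg.2 ht1) hφ.le)]
        have h2 : 0 ≤ (1 - t) * P.phi x := mul_nonneg (sub_nonneg.2 ht1) hφ.le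
        have h3 := mul_pos ht hφ
        nlinarith
      have hterm : ∀ j, π j * (P.ht j d x - (1 - t) * P.phi x * SignType.sign (π j)) =
          (π j * P.ht j d x - |π j| * P.phi x) + t * (|π j| * P.phi x) := fun j => by
        rw [← self_mul_sign]; ring
      simp only [hterm, Finset.sum_add_distrib, ← Finset.mul_sum] at this
      rw [lagr]
      linarith
    have := nonneg_of_forall_pos_add_mul' (a := S.lagr P ξ π (P.phi x) d x - w)
      (b := ∑ j, |π j| * P.phi x) fun t ht => by
        rcases le_total t 1 with h | h
        · exact hle1 t ht h
        · have := hle1 1 one_pos le_rfl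
          nlinarith
    linarith
  -- The eMFCQ gives ξ = π = 0, so w = 1, while `hlag` at the origin gives w ≤ 0.
  have hmem := toLp_mem_M₀ hP hS hA hx hξ hS.ρ_pos fun d hd => hw.trans (hlag d hd)
  rw [hCQ, mem_singleton_iff, Prod.mk_eq_zero] at hmem
  have hξ0 : ξ = 0 := by simpa using hmem.1
  have hπ0 : π = 0 := by simpa using hmem.2
  have := hlag 0 (zero_mem_box hS.ρ_pos.le hx)
  subst hξ0 hπ0
  simp [lagr] at this hsum
  linarith

/-- Halving a decreasing direction keeps it decreasing by convexity and leaves room ρ/2 in the box.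
At nearby `y` the direction is shifted by `x - y`, which keeps its endpoint in `K`; continuity of
the violation does the rest. -/
theorem exists_le_drop (hP : P.Standing) (hS : S.Admissible)
    (hA : S.AssumptionAOn P Od Ox) {x : Vec n} (hx : x ∈ P.K) (hCQ : P.EMFCQ x)
    (hφ : 0 < P.phi x) : ∃ δ > 0, ∀ᶠ y in 𝓝[P.K] x, δ ≤ S.drop P y := by
  obtain ⟨d, hd, hlt⟩ := exists_modelViolation_lt_phi hP hS hA hx hCQ hφ
  set e : Vec n := (1 / 2 : ℝ) • d with he
  have he' : e = (1 / 2 : ℝ) • d + (1 / 2 : ℝ) • (0 : Vec n) := by simp [he]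
  have h0 : (0 : Vec n) ∈ box P S.ρ x := zero_mem_box hS.ρ_pos.le hx
  have helt : S.modelViolation P e x < P.phi x := by
    refine violation_lt_of_forall_lt hφ (fun i => ?_) fun j => ?_
    · have h1 := (convexOn_gt hP hA hx hS.ρ_lt.le i).2 hd h0 (by norm_num : (0 : ℝ) ≤ 1 / 2)
        (by norm_num : (0 : ℝ) ≤ 1 / 2) (by norm_num)
      simp only [← he', hA.A7 i x hx, smul_eq_mul] at h1
      have h2 : S.gt i d x ≤ S.modelViolation P d x := gt_le_modelViolation i d x
      have h3 : P.g i x ≤ P.phi x := P.g_le_phi i x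
      linarith
    · have h1 := P.ht_affine j x d 0 (a := 1 / 2) (b := 1 / 2) (by norm_num)
      rw [← he', Problem.ht_zero] at h1
      have h2 : |P.ht j d x| ≤ S.modelViolation P d x := abs_ht_le_modelViolation j d x
      have h3 : |P.h j x| ≤ P.phi x := P.abs_h_le_phi j x
      rw [h1]
      rw [abs_le] at h2 h3
      rw [abs_lt]
      constructor <;> linarith
  have hcont : ContinuousOn (fun y => P.phi y - S.modelViolation P (e + (x - y)) y) P.K :=
    (P.continuousOn_phi hP).sub ((continuousOn_modelViolation hP hA).comp
      (f := fun y => (e + (x - y), y)) (by fun_prop) fun y hy => ⟨trivial, hy⟩)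
  have hpos : 0 < P.phi x - S.modelViolation P e x := sub_pos.2 helt
  refine ⟨(P.phi x - S.modelViolation P e x) / 2, half_pos hpos, ?_⟩
  have hev := (hcont x hx).eventually (lt_mem_nhds (a := (P.phi x - S.modelViolation P e x) / 2)
    (by dsimp only; rw [sub_self, add_zero]; exact half_lt_self hpos))
  have hball : ∀ᶠ y in 𝓝[P.K] x, dist y x < S.ρ / 2 :=
    nhdsWithin_le_nhds (Metric.ball_mem_nhds x (half_pos hS.ρ_pos))
  filter_upwards [hev, hball, self_mem_nhdsWithin] with y hy hy2 hyK
  refine hy.le.trans (sub_modelViolation_le_drop ⟨fun i => ?_, ?_⟩)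
  · have h1 := hd.1 i
    have h2 := abs_apply_le_norm (x - y) i
    rw [← dist_eq_norm, dist_comm] at h2
    have h3 : |e i| ≤ S.ρ / 2 := by
      rw [he, PiLp.smul_apply, smul_eq_mul, abs_mul]
      norm_num
      linarith
    rw [PiLp.add_apply]
    exact (abs_add_le _ _).trans (by linarith)
  · have h1 : y + (e + (x - y)) = x + e := by abel
    rw [h1]
    exact (smul_mem_box hP hS.ρ_pos.le hx hd (by norm_num : (0 : ℝ) ≤ 1 / 2) (by norm_num)).2

/-! ### Multipliers of the subproblem and their limits -/

variable (S P)

/-- Normalized Fritz John multipliers of the subproblem at `x`. -/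
structure IsMultiplier (x : Vec n) (w : ℝ) (ξ : Fin m → ℝ) (π : Fin p → ℝ) : Prop where
  w_nonneg : 0 ≤ w
  ξ_nonneg : ∀ i, 0 ≤ ξ i
  sum_eq : w + ∑ i, ξ i + ∑ j, |π j| = 1
  lagr_nonneg : ∀ d ∈ box P S.β x,
    0 ≤ w * (S.obj P d x - S.obj P (S.dir P x) x) + S.lagr P ξ π (S.kappa P x) d x

variable {S P}

/-- Optimality of `dir` is the solvability hypothesis of `exists_multipliers`. The interval for `H`
is now closed, so the choice `κ * sign π` is allowed at once. No constraint qualification enters, so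
`w` may be zero here. -/
theorem exists_isMultiplier (hP : P.Standing) (hS : S.Admissible)
    (hA : S.AssumptionAOn P Od Ox) {x : Vec n} (hx : x ∈ P.K) :
    ∃ w ξ π, S.IsMultiplier P x w ξ π := by
  have hκ := kappa_nonneg hP hS hA hx
  have hc := convex_box hP S.β x
  obtain ⟨w, ξ, π, hw, hξ, hsum, hmain⟩ := exists_multipliers hc
    ⟨0, zero_mem_box hS.β_pos.le hx⟩ (F := fun d => S.obj P d x - S.obj P (S.dir P x) x)
    (G := fun i d => S.gt i d x - S.kappa P x) (H := fun j d => P.ht j d x)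
    (J := Icc (-S.kappa P x) (S.kappa P x))
    ((convexOn_obj hP hA hx).sub (concaveOn_const _ hc))
    (fun i => (convexOn_gt hP hA hx le_rfl i).sub (concaveOn_const _ hc))
    (fun j d _ e _ a b hab => P.ht_affine j x d e hab) (convex_Icc _ _)
    ⟨0, by simpa using hκ⟩
    (fun d hd h1 h2 => sub_nonneg.2 (obj_dir_le hP hS hA hx hd
      ((violation_le_iff hκ).2 ⟨fun i => (sub_neg.1 (h1 i)).le, fun j => abs_le.2 (h2 j)⟩)))
  refine ⟨w, ξ, π, hw, hξ, hsum, fun d hd => ?_⟩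
  have := hmain d hd (fun j => S.kappa P x * SignType.sign (π j)) fun j => by
    rw [mem_Icc, ← abs_le, abs_mul, abs_of_nonneg hκ]
    have h1 : |((SignType.sign (π j) : SignType) : ℝ)| ≤ 1 := by
      rcases SignType.sign (π j) with _ | _ | _ <;> simp
    exact mul_le_of_le_one_right hκ h1
  have hterm : ∀ j, π j * (P.ht j d x - S.kappa P x * SignType.sign (π j)) =
      π j * P.ht j d x - |π j| * S.kappa P x := fun j => by
    rw [← self_mul_sign]; ring
  simp only [hterm] at this
  rw [lagr]
  linarith

/-- Reduces the multiplier inequality to a scalar one in the violation alone. -/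
theorem lagr_le {ξ : Fin m → ℝ} {π : Fin p → ℝ} (hξ : ∀ i, 0 ≤ ξ i) (κ : ℝ) (d x : Vec n) :
    S.lagr P ξ π κ d x ≤ (∑ i, ξ i + ∑ j, |π j|) * (S.modelViolation P d x - κ) := by
  rw [lagr, add_mul, Finset.sum_mul, Finset.sum_mul]
  refine add_le_add (Finset.sum_le_sum fun i _ => ?_) (Finset.sum_le_sum fun j _ => ?_)
  · exact mul_le_mul_of_nonneg_left (sub_le_sub_right (gt_le_modelViolation i d x) κ) (hξ i)
  · have h1 := mul_le_mul_of_nonneg_left (abs_ht_le_modelViolation (S := S) (P := P) j d x)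
      (abs_nonneg (π j))
    rw [← abs_mul] at h1
    have h2 := le_abs_self (π j * P.ht j d x)
    rw [mul_sub]
    linarith

theorem lagr_mul (a : ℝ) (ξ : Fin m → ℝ) (π : Fin p → ℝ) (d x : Vec n) :
    S.lagr P (fun i => a * ξ i) (fun j => a * π j) 0 d x = a * S.lagr P ξ π 0 d x := by
  simp only [lagr, sub_zero, mul_zero, mul_add, Finset.mul_sum, mul_assoc]

theorem IsMultiplier.norm_le {x : Vec n} {w : ℝ} {ξ : Fin m → ℝ} {π : Fin p → ℝ}
    (h : S.IsMultiplier P x w ξ π) : w ≤ 1 ∧ ‖ξ‖ ≤ 1 ∧ ‖π‖ ≤ 1 := by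
  have h1 := Finset.sum_nonneg fun i (_ : i ∈ Finset.univ) => h.ξ_nonneg i
  have h2 := Finset.sum_nonneg fun j (_ : j ∈ Finset.univ) => abs_nonneg (π j)
  have h3 := h.sum_eq
  have h4 := h.w_nonneg
  refine ⟨by linarith, (pi_norm_le_iff_of_nonneg zero_le_one).2 fun i => ?_,
    (pi_norm_le_iff_of_nonneg zero_le_one).2 fun j => ?_⟩
  · rw [Real.norm_of_nonneg (h.ξ_nonneg i)]
    have := Finset.single_le_sum (fun i _ => h.ξ_nonneg i) (Finset.mem_univ i)
    linarith
  · have := Finset.single_le_sum (fun j _ => abs_nonneg (π j)) (Finset.mem_univ j)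
    rw [Real.norm_eq_abs]
    linarith

theorem tendsto_lagr (hP : P.Standing) (hA : S.AssumptionAOn P Od Ox) {ι : Type*} {l : Filter ι}
    {y d : ι → Vec n} {ξ : ι → Fin m → ℝ} {π : ι → Fin p → ℝ} {κ : ι → ℝ} {y₀ d₀ : Vec n}
    {ξ₀ : Fin m → ℝ} {π₀ : Fin p → ℝ} {κ₀ : ℝ} (hyK : ∀ k, y k ∈ P.K) (hy₀ : y₀ ∈ P.K)
    (hy : Tendsto y l (𝓝 y₀)) (hd : Tendsto d l (𝓝 d₀)) (hξ : Tendsto ξ l (𝓝 ξ₀))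
    (hπ : Tendsto π l (𝓝 π₀)) (hκ : Tendsto κ l (𝓝 κ₀)) :
    Tendsto (fun k => S.lagr P (ξ k) (π k) (κ k) (d k) (y k)) l
      (𝓝 (S.lagr P ξ₀ π₀ κ₀ d₀ y₀)) := by
  have hpair : Tendsto (fun k => (d k, y k)) l (𝓝[univ ×ˢ P.K] (d₀, y₀)) :=
    tendsto_nhdsWithin_iff.2 ⟨hd.prodMk_nhds hy, Eventually.of_forall fun k => ⟨trivial, hyK k⟩⟩
  refine (tendsto_finsetSum _ fun i _ => ?_).add (tendsto_finsetSum _ fun j _ => ?_)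
  · exact (tendsto_pi_nhds.1 hξ i).mul
      (((continuousOn_gt hA i (d₀, y₀) ⟨trivial, hy₀⟩).tendsto.comp hpair).sub hκ)
  · exact ((tendsto_pi_nhds.1 hπ j).mul
      ((P.continuousOn_ht hP j (d₀, y₀) ⟨trivial, hy₀⟩).tendsto.comp hpair)).sub
      ((tendsto_pi_nhds.1 hπ j).abs.mul hκ)

theorem tendsto_modelViolation (hP : P.Standing) (hA : S.AssumptionAOn P Od Ox) {ι : Type*}
    {l : Filter ι} {y d : ι → Vec n} {y₀ d₀ : Vec n} (hyK : ∀ k, y k ∈ P.K) (hy₀ : y₀ ∈ P.K)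
    (hy : Tendsto y l (𝓝 y₀)) (hd : Tendsto d l (𝓝 d₀)) :
    Tendsto (fun k => S.modelViolation P (d k) (y k)) l (𝓝 (S.modelViolation P d₀ y₀)) := by
  have hpair : Tendsto (fun k => (d k, y k)) l (𝓝[univ ×ˢ P.K] (d₀, y₀)) :=
    tendsto_nhdsWithin_iff.2 ⟨hd.prodMk_nhds hy, Eventually.of_forall fun k => ⟨trivial, hyK k⟩⟩
  have hcont := continuousOn_modelViolation hP hA (d₀, y₀) ⟨trivial, hy₀⟩
  exact hcont.tendsto.comp hpair

theorem tendsto_obj (hP : P.Standing) (hA : S.AssumptionAOn P Od Ox) {ι : Type*} {l : Filter ι}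
    {y d : ι → Vec n} {y₀ d₀ : Vec n} (hyK : ∀ k, y k ∈ P.K) (hy₀ : y₀ ∈ P.K)
    (hdb : ∀ᶠ k in l, d k ∈ box P S.β (y k)) (hd₀ : d₀ ∈ box P S.β y₀)
    (hy : Tendsto y l (𝓝 y₀)) (hd : Tendsto d l (𝓝 d₀)) :
    Tendsto (fun k => S.obj P (d k) (y k)) l (𝓝 (S.obj P d₀ y₀)) := by
  have hpair : Tendsto (fun k => (d k, y k)) l (𝓝[S.graph P] (d₀, y₀)) :=
    tendsto_nhdsWithin_iff.2 ⟨hd.prodMk_nhds hy, hdb.mono fun k hk => ⟨hyK k, hk⟩⟩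
  exact (continuousOn_obj hP hA (d₀, y₀) ⟨hy₀, hd₀⟩).tendsto.comp hpair

/-- The shift by `y₀ - y k` fixes the endpoint `y₀ + d` in `K` and enlarges the direction by an
amount tending to 0; hence the slightly larger box. -/
theorem eventually_mem_box {l : Filter ℕ} {y : ℕ → Vec n} {y₀ d : Vec n} {r s : ℝ} (hrs : r < s)
    (hy : Tendsto y l (𝓝 y₀)) (hd : d ∈ box P r y₀) :
    ∀ᶠ k in l, d + (y₀ - y k) ∈ box P s (y k) := by
  filter_upwards [hy.eventually (Metric.ball_mem_nhds y₀ (sub_pos.2 hrs))] with k hk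
  refine ⟨fun i => ?_, ?_⟩
  · have h2 := abs_apply_le_norm (y₀ - y k) i
    rw [← dist_eq_norm, dist_comm] at h2
    have h3 := hd.1 i
    rw [PiLp.add_apply]
    have h4 : dist (y k) y₀ < s - r := hk
    exact (abs_add_le _ _).trans (by linarith)
  · have h1 : y k + (d + (y₀ - y k)) = y₀ + d := by abel
    rw [h1]
    exact hd.2

/-- The multiplier inequality is stable under limits. -/
theorem limit_multiplier (hP : P.Standing) (hA : S.AssumptionAOn P Od Ox)
    {y : ℕ → Vec n} {w : ℕ → ℝ} {ξ : ℕ → Fin m → ℝ} {π : ℕ → Fin p → ℝ} {y₀ : Vec n} {w₀ : ℝ}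
    {ξ₀ : Fin m → ℝ} {π₀ : Fin p → ℝ} {κ₀ c r : ℝ} (hyK : ∀ k, y k ∈ P.K) (hy₀ : y₀ ∈ P.K)
    (hmult : ∀ k, S.IsMultiplier P (y k) (w k) (ξ k) (π k))
    (hy : Tendsto y atTop (𝓝 y₀)) (hw : Tendsto w atTop (𝓝 w₀)) (hξ : Tendsto ξ atTop (𝓝 ξ₀))
    (hπ : Tendsto π atTop (𝓝 π₀)) (hκ : Tendsto (fun k => S.kappa P (y k)) atTop (𝓝 κ₀))
    (hc : Tendsto (fun k => w k * S.obj P (S.dir P (y k)) (y k)) atTop (𝓝 c)) (hr : r < S.β)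
    {d : Vec n} (hd : d ∈ box P r y₀) :
    0 ≤ w₀ * S.obj P d y₀ - c + S.lagr P ξ₀ π₀ κ₀ d y₀ := by
  have hdlim : Tendsto (fun k => d + (y₀ - y k)) atTop (𝓝 d) := by
    simpa using (tendsto_const_nhds (x := d)).add ((tendsto_const_nhds (x := y₀)).sub hy)
  have hbox := eventually_mem_box hr hy hd
  have hlim := ((hw.mul (tendsto_obj hP hA hyK hy₀ hbox (box_mono hr.le y₀ hd) hy hdlim)).sub
    hc).add (tendsto_lagr hP hA hyK hy₀ hy hdlim hξ hπ hκ)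
  refine ge_of_tendsto hlim ?_
  filter_upwards [hbox] with k hk
  have := (hmult k).lagr_nonneg _ hk
  rwa [mul_sub] at this

/-- Squeezed by 0 ≤ κ ≤ φ, without any continuity of κ itself. -/
theorem tendsto_kappa_zero (hP : P.Standing) (hS : S.Admissible) (hA : S.AssumptionAOn P Od Ox)
    {y : ℕ → Vec n} {y₀ : Vec n} (hyK : ∀ k, y k ∈ P.K) (hy₀ : y₀ ∈ P.K)
    (hy : Tendsto y atTop (𝓝 y₀)) (hφ : P.phi y₀ = 0) :
    Tendsto (fun k => S.kappa P (y k)) atTop (𝓝 0) := by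
  have h1 : Tendsto (fun k => P.phi (y k)) atTop (𝓝 0) := by
    rw [← hφ]
    exact (P.continuousOn_phi hP y₀ hy₀).tendsto.comp
      (tendsto_nhdsWithin_iff.2 ⟨hy, Eventually.of_forall hyK⟩)
  exact squeeze_zero (fun k => kappa_nonneg hP hS hA (hyK k))
    (fun k => kappa_le_phi hS hA (hyK k)) h1

theorem exists_abs_obj_le (hP : P.Standing) (hA : S.AssumptionAOn P Od Ox) {T : Set (Vec n)}
    (hTK : T ⊆ P.K) (hT : IsCompact T) :
    ∃ M : ℝ, ∀ x ∈ T, ∀ d ∈ box P S.β x, |S.obj P d x| ≤ M := by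
  have hcomp : IsCompact ((infBall n S.β ×ˢ T) ∩ {z | z.2 + z.1 ∈ P.K}) :=
    ((isCompact_infBall n S.β).prod hT).inter_right (hP.K_closed.preimage (by fun_prop))
  obtain ⟨M, hM⟩ := hcomp.exists_bound_of_continuousOn
    ((continuousOn_obj hP hA).mono fun z hz => ⟨hTK hz.1.2, hz.1.1, hz.2⟩)
  exact ⟨M, fun x hx d hd => hM (d, x) ⟨⟨hd.1, hx⟩, hd.2⟩⟩

/-- Under the extended constraint qualification, the weight of the objective in the multipliers is
bounded away from zero on compact sets. -/
theorem exists_isMultiplier_ge (hP : P.Standing) (hS : S.Admissible)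
    (hA : S.AssumptionAOn P Od Ox) {T : Set (Vec n)} (hTK : T ⊆ P.K) (hT : IsCompact T)
    (hCQ : ∀ x ∈ T, P.EMFCQ x) :
    ∃ ω : ℝ, 0 < ω ∧ ∀ x ∈ T, ∃ w ξ π, ω ≤ w ∧ S.IsMultiplier P x w ξ π := by
  by_contra! hcon
  have hk : ∀ k : ℕ, ∃ x ∈ T, ∃ w ξ π, w < 1 / ((k : ℝ) + 1) ∧ S.IsMultiplier P x w ξ π := by
    intro k
    obtain ⟨x, hxT, hx⟩ := hcon (1 / ((k : ℝ) + 1)) (by positivity)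
    obtain ⟨w, ξ, π, hm⟩ := exists_isMultiplier hP hS hA (hTK hxT)
    exact ⟨x, hxT, w, ξ, π, not_le.1 fun hle => hx w ξ π hle hm, hm⟩
  choose x hxT w ξ π hwk hm using hk
  obtain ⟨⟨y₀, ξ₀, π₀⟩, ⟨hy₀T, -, -⟩, s, hs, hlim⟩ := (hT.prod
    ((isCompact_closedBall (0 : Fin m → ℝ) 1).prod
      (isCompact_closedBall (0 : Fin p → ℝ) 1))).tendsto_subseq
    (x := fun k => (x k, ξ k, π k)) fun k => ⟨hxT k, by simpa using (hm k).norm_le.2.1,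
      by simpa using (hm k).norm_le.2.2⟩
  have hy : Tendsto (x ∘ s) atTop (𝓝 y₀) := (continuous_fst.tendsto _).comp hlim
  have hξ : Tendsto (ξ ∘ s) atTop (𝓝 ξ₀) :=
    ((continuous_fst.comp continuous_snd).tendsto _).comp hlim
  have hπ : Tendsto (π ∘ s) atTop (𝓝 π₀) :=
    ((continuous_snd.comp continuous_snd).tendsto _).comp hlim
  have hw : Tendsto (w ∘ s) atTop (𝓝 0) :=
    (squeeze_zero (fun k => (hm k).w_nonneg) (fun k => (hwk k).le)
      tendsto_one_div_add_atTop_nhds_zero_nat).comp hs.tendsto_atTop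
  have hyK : ∀ k, (x ∘ s) k ∈ P.K := fun k => hTK (hxT _)
  have hy₀ : y₀ ∈ P.K := hTK hy₀T
  obtain ⟨M, hM⟩ := exists_abs_obj_le hP hA hTK hT
  rcases (P.phi_nonneg y₀).eq_or_lt with hφ | hφ
  -- Feasible limit: objective values are bounded and w → 0, so only the constraint terms survive.
  -- They put the limit in M₀ = {0}, against total mass 1.
  · have hc : Tendsto (fun k => (w ∘ s) k * S.obj P (S.dir P ((x ∘ s) k)) ((x ∘ s) k)) atTop
        (𝓝 0) := by
      refine squeeze_zero_norm (a := fun k => (w ∘ s) k * M) (fun k => ?_) (by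
        simpa using hw.mul_const M)
      have h0 : 0 ≤ (w ∘ s) k := (hm (s k)).w_nonneg
      rw [norm_mul, Real.norm_of_nonneg h0]
      exact mul_le_mul_of_nonneg_left (hM _ (hxT _) _ (dir_mem_box hP hS hA (hyK k))) h0
    have hlag : ∀ d ∈ box P (S.β / 2) y₀, 0 ≤ S.lagr P ξ₀ π₀ (P.phi y₀) d y₀ := by
      intro d hd
      have := limit_multiplier hP hA hyK hy₀ (fun k => hm (s k)) hy hw hξ hπ
        (tendsto_kappa_zero hP hS hA hyK hy₀ hy hφ.symm) hc (half_lt_self hS.β_pos) hd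
      rw [← hφ]
      linarith
    have hmem := toLp_mem_M₀ hP hS hA hy₀ (fun i => ge_of_tendsto' (tendsto_pi_nhds.1 hξ i)
      fun k => (hm _).ξ_nonneg i) (half_pos hS.β_pos) hlag
    rw [hCQ y₀ hy₀T, mem_singleton_iff, Prod.mk_eq_zero] at hmem
    have hξ0 : ξ₀ = 0 := by simpa using hmem.1
    have hπ0 : π₀ = 0 := by simpa using hmem.2
    have hsum : Tendsto (fun k => (w ∘ s) k + ∑ i, (ξ ∘ s) k i + ∑ j, |(π ∘ s) k j|) atTop
        (𝓝 (0 + ∑ i, ξ₀ i + ∑ j, |π₀ j|)) :=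
      (hw.add (tendsto_finsetSum _ fun i _ => tendsto_pi_nhds.1 hξ i)).add
        (tendsto_finsetSum _ fun j _ => (tendsto_pi_nhds.1 hπ j).abs)
    have hone : (fun k => (w ∘ s) k + ∑ i, (ξ ∘ s) k i + ∑ j, |(π ∘ s) k j|) = fun _ => 1 :=
      funext fun k => (hm (s k)).sum_eq
    rw [hone, hξ0, hπ0] at hsum
    simp [tendsto_const_nhds_iff] at hsum
  -- Infeasible limit: the minimizer of the violation lies below κ by (1 - λ)·drop. Testing the
  -- multiplier inequality there gives 0 ≤ 2Mw - (1 - w)(1 - λ)δ, impossible as w → 0.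
  · obtain ⟨δ, hδ, hev⟩ := exists_le_drop hP hS hA hy₀ (hCQ y₀ hy₀T) hφ
    have hev' := (tendsto_nhdsWithin_iff.2 ⟨hy, Eventually.of_forall hyK⟩).eventually hev
    have hlim0 : Tendsto (fun k => (w ∘ s) k * (2 * M) - (1 - (w ∘ s) k) * ((1 - S.lam) * δ)) atTop
        (𝓝 (0 * (2 * M) - (1 - 0) * ((1 - S.lam) * δ))) :=
      (hw.mul_const _).sub ((tendsto_const_nhds.sub hw).mul_const _)
    have hge := ge_of_tendsto (b := 0) hlim0 (by
      filter_upwards [hev'] with k hk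
      obtain ⟨d, hd, hdv⟩ := exists_isMinOn_modelViolation hP hS hA (hyK k)
      have hd' := box_mono hS.ρ_lt.le _ hd
      have h1 := (hm (s k)).lagr_nonneg d hd'
      have h2 := lagr_le (S := S) (P := P) (π := π (s k)) (hm (s k)).ξ_nonneg
        (S.kappa P ((x ∘ s) k)) d ((x ∘ s) k)
      have h3 : ∑ i, ξ (s k) i + ∑ j, |π (s k) j| = 1 - w (s k) := by
        linarith [(hm (s k)).sum_eq]
      rw [h3, hdv, kappa_eq] at h2
      have h4 := abs_le.1 (hM _ (hxT (s k)) d hd')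
      have h5 := abs_le.1 (hM _ (hxT (s k)) _ (dir_mem_box hP hS hA (hTK (hxT (s k)))))
      have h6 : w (s k) * (S.obj P d (x (s k)) - S.obj P (S.dir P (x (s k))) (x (s k))) ≤
          w (s k) * (2 * M) :=
        mul_le_mul_of_nonneg_left (by linarith)
          (hm (s k)).w_nonneg
      have h7 : (1 - w (s k)) * ((1 - S.lam) * δ) ≤
          (1 - w (s k)) * ((1 - S.lam) * S.drop P (x (s k))) :=
        mul_le_mul_of_nonneg_left (mul_le_mul_of_nonneg_left hk (sub_nonneg.2 hS.lam_lt.le))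
          (sub_nonneg.2 (hm (s k)).norm_le.1)
      simp only [Function.comp_apply] at h1 h2 h6 ⊢
      rw [kappa_eq] at h1
      nlinarith)
    have := mul_pos (sub_pos.2 hS.lam_lt) hδ
    linarith

/-! ### KKT points as limits of vanishing directions -/

/-- A criterion for KKT points in terms of the model functions. -/
theorem isKKT_of_lagr_nonneg (hP : P.Standing) (hS : S.Admissible)
    (hA : S.AssumptionAOn P Od Ox) {x : Vec n} (hx : x ∈ P.K) (hφ : P.phi x = 0)
    {ξ : Fin m → ℝ} {π : Fin p → ℝ} (hξ : ∀ i, 0 ≤ ξ i) {r : ℝ} (hr : 0 < r)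
    (h : ∀ d ∈ box P r x, 0 ≤ S.obj P d x - S.obj P 0 x + S.lagr P ξ π 0 d x) : P.IsKKT x := by
  have hfeas := P.satisfiesConstraints_iff_phi_eq_zero.2 hφ
  have h00 := h 0 (zero_mem_box hr.le hx)
  rw [sub_self, zero_add] at h00
  obtain ⟨h1, -, h0⟩ := complementarity hA hx hξ (by rwa [hφ])
  have hcone := toLp_mem_normalCone_nonposOrthant hξ h1
  simp only [hφ, sub_zero] at hcone h0
  -- The subdifferential is taken relative to `K` and already absorbs the normal cone: the whole
  -- residual serves as subgradient, with normal vector 0.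
  refine ⟨hx, hfeas, (WithLp.toLp 2 ξ, WithLp.toLp 2 π), hcone, ⟨?_, ?_⟩,
    -(gradient P.f x + P.multGrad x (WithLp.toLp 2 ξ) (WithLp.toLp 2 π)), ⟨hx, fun y hy => ?_⟩,
    0, ⟨hx, by simp⟩, by simp only; abel⟩
  · rw [mem_singleton_iff]
    ext j
    exact hfeas.2 j
  · rintro y rfl
    have : WithLp.toLp 2 (fun j => P.h j x) = 0 := by
      ext j
      exact hfeas.2 j
    simp [this]
  · obtain ⟨r₀, hr₀, hr₁, hsm⟩ := exists_smul_mem_infBall (y - x) hr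
    have hg := hasGradientAt_lagr hS hA hx 1 ξ π 0
    have := gradient_add_nonneg (d := y - x) (B := P.q y - P.q x) hr₀ hg fun t ht htr => by
      have h3 := h (t • (y - x)) ⟨hsm t ht htr,
        hP.K_convex.add_smul_sub_mem hx hy ⟨ht.le, htr.le.trans hr₁⟩⟩
      have h4 := hP.q_convex.2 hx hy (sub_nonneg.2 (htr.le.trans hr₁)) ht.le (by ring)
      have h5 : (1 - t) • x + t • y = x + t • (y - x) := by module
      rw [h5, smul_eq_mul, smul_eq_mul] at h4
      simp only [obj, add_zero] at h3
      rw [h0]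
      linarith
    rw [one_smul] at this
    rw [inner_neg_left]
    linarith

/-- Limit points along which the directions vanish are KKT points. -/
theorem isKKT_of_tendsto (hP : P.Standing) (hS : S.Admissible)
    (hA : S.AssumptionAOn P Od Ox) {T : Set (Vec n)} (hTK : T ⊆ P.K) (hT : IsCompact T)
    (hCQ : ∀ x ∈ T, P.EMFCQ x) {x : ℕ → Vec n} (hxT : ∀ k, x k ∈ T) {y₀ : Vec n}
    (hx : Tendsto x atTop (𝓝 y₀)) (hdir : Tendsto (fun k => S.dir P (x k)) atTop (𝓝 0)) :
    P.IsKKT y₀ := by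
  have hy₀T : y₀ ∈ T := hT.isClosed.mem_of_tendsto hx (Eventually.of_forall hxT)
  have hy₀ : y₀ ∈ P.K := hTK hy₀T
  have hxK : ∀ k, x k ∈ P.K := fun k => hTK (hxT k)
  have hxW : Tendsto x atTop (𝓝[P.K] y₀) :=
    tendsto_nhdsWithin_iff.2 ⟨hx, Eventually.of_forall hxK⟩
  -- At an infeasible limit the model violation at d(x) would stay below φ(x) - λδ, yet with d → 0
  -- it tends to φ(y₀).
  have hφ : P.phi y₀ = 0 := by
    by_contra hne
    obtain ⟨δ, hδ, hev⟩ := exists_le_drop hP hS hA hy₀ (hCQ y₀ hy₀T)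
      (lt_of_le_of_ne (P.phi_nonneg y₀) (Ne.symm hne))
    have h1 := tendsto_modelViolation hP hA hxK hy₀ hx hdir
    have h2 : Tendsto (fun k => P.phi (x k) - S.lam * δ) atTop (𝓝 (P.phi y₀ - S.lam * δ)) :=
      ((P.continuousOn_phi hP y₀ hy₀).tendsto.comp hxW).sub_const _
    rw [modelViolation_zero hA hy₀] at h1
    have := le_of_tendsto_of_tendsto h1 h2 (by
      filter_upwards [hxW.eventually hev] with k hk
      have h3 := modelViolation_dir_le hP hS hA (hxK k)
      rw [kappa_eq] at h3
      have := mul_le_mul_of_nonneg_left hk hS.lam_pos.le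
      linarith)
    have := mul_pos hS.lam_pos hδ
    linarith
  obtain ⟨ω, hω, hmul⟩ := exists_isMultiplier_ge hP hS hA hTK hT hCQ
  choose w ξ π hωw hm using fun k => hmul (x k) (hxT k)
  obtain ⟨⟨w₀, ξ₀, π₀⟩, -, s, hs, hlim⟩ := ((isCompact_Icc (a := (0 : ℝ)) (b := 1)).prod
    ((isCompact_closedBall (0 : Fin m → ℝ) 1).prod
      (isCompact_closedBall (0 : Fin p → ℝ) 1))).tendsto_subseq
    (x := fun k => (w k, ξ k, π k)) fun k => ⟨⟨(hm k).w_nonneg, (hm k).norm_le.1⟩,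
      by simpa using (hm k).norm_le.2.1, by simpa using (hm k).norm_le.2.2⟩
  have hw : Tendsto (w ∘ s) atTop (𝓝 w₀) := (continuous_fst.tendsto _).comp hlim
  have hξ : Tendsto (ξ ∘ s) atTop (𝓝 ξ₀) :=
    ((continuous_fst.comp continuous_snd).tendsto _).comp hlim
  have hπ : Tendsto (π ∘ s) atTop (𝓝 π₀) :=
    ((continuous_snd.comp continuous_snd).tendsto _).comp hlim
  have hy := hx.comp hs.tendsto_atTop
  have hw₀ : 0 < w₀ := hω.trans_le (ge_of_tendsto' hw fun k => hωw _)
  have hobj : Tendsto (fun k => S.obj P (S.dir P ((x ∘ s) k)) ((x ∘ s) k)) atTop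
      (𝓝 (S.obj P 0 y₀)) :=
    tendsto_obj hP hA (fun k => hxK (s k)) hy₀
      (Eventually.of_forall fun k => dir_mem_box hP hS hA (hxK (s k)))
      (zero_mem_box hS.β_pos.le hy₀) hy (hdir.comp hs.tendsto_atTop)
  -- Since w₀ ≥ ω > 0, dividing by w₀ turns Fritz John multipliers into KKT multipliers.
  refine isKKT_of_lagr_nonneg hP hS hA hy₀ hφ (ξ := fun i => w₀⁻¹ * ξ₀ i)
    (π := fun j => w₀⁻¹ * π₀ j) (fun i => mul_nonneg (inv_pos.2 hw₀).le
      (ge_of_tendsto' (tendsto_pi_nhds.1 hξ i) fun k => (hm _).ξ_nonneg i))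
    (half_pos hS.β_pos) fun d hd => ?_
  have h1 := limit_multiplier hP hA (fun k => hxK (s k)) hy₀ (fun k => hm (s k)) hy hw hξ hπ
    (tendsto_kappa_zero hP hS hA (fun k => hxK (s k)) hy₀ hy hφ) (hw.mul hobj)
    (half_lt_self hS.β_pos) hd
  have h2 := mul_nonneg (inv_pos.2 hw₀).le h1
  rw [← mul_sub, mul_add, inv_mul_cancel_left₀ hw₀.ne'] at h2
  rw [lagr_mul]
  exact h2

end Method

/-! Sequences generated with diminishing stepsizes. -/

/-- Once Cγ < c/2 the quadratic error costs at most half of the decrease; the rest telescopes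
against the lower bound `l`. -/
theorem summable_of_descent {γ b W : ℕ → ℝ} {c C l : ℝ} (hγ : ∀ k, 0 < γ k)
    (hγ0 : Tendsto γ atTop (𝓝 0)) (hb : ∀ k, 0 ≤ b k) (hc : 0 < c) (hl : ∀ k, l ≤ W k)
    (hW : ∀ k, W (k + 1) ≤ W k - γ k * c * b k + C * γ k ^ 2 * b k) :
    Summable fun k => γ k * b k := by
  have hlim : Tendsto (fun k => C * γ k) atTop (𝓝 0) := by simpa using hγ0.const_mul C
  obtain ⟨N, hN⟩ := eventually_atTop.1 (hlim.eventually (gt_mem_nhds (half_pos hc)))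
  rw [← summable_nat_add_iff N]
  refine summable_of_sum_range_le (c := (W N - l) * (2 / c))
    (fun k => mul_nonneg (hγ _).le (hb _)) fun k => ?_
  have hterm : ∀ i, γ (i + N) * b (i + N) ≤ (W (i + N) - W (i + 1 + N)) * (2 / c) := by
    intro i
    have h1 := hW (i + N)
    rw [show i + N + 1 = i + 1 + N by ring] at h1
    have h2 := mul_le_mul_of_nonneg_right (hN (i + N) (Nat.le_add_left _ _)).le
      (mul_nonneg (hγ (i + N)).le (hb (i + N)))
    rw [mul_div_assoc', le_div_iff₀ hc]
    nlinarith
  refine (Finset.sum_le_sum fun i _ => hterm i).trans ?_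
  rw [← Finset.sum_mul, Finset.sum_range_sub' (fun i => W (i + N))]
  have := hl (k + N)
  rw [zero_add]
  exact mul_le_mul_of_nonneg_right (by linarith) (by positivity)

/-- If `b ≥ ε` eventually, then γ ≤ ε⁻¹γb would be summable. -/
theorem frequently_lt_of_summable {γ b : ℕ → ℝ} (hγ : ∀ k, 0 < γ k)
    (hsum : Tendsto (fun N => ∑ k ∈ Finset.range N, γ k) atTop atTop)
    (hb : Summable fun k => γ k * b k) {ε : ℝ} (hε : 0 < ε) : ∃ᶠ k in atTop, b k < ε := by
  intro hcon
  have hs : Summable γ := by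
    refine Summable.of_norm_bounded_eventually_nat (hb.mul_right ε⁻¹) ?_
    filter_upwards [hcon] with k hk
    rw [Real.norm_of_nonneg (hγ k).le, mul_assoc]
    refine le_mul_of_one_le_right (hγ k).le ?_
    rw [← div_eq_mul_inv, one_le_div hε]
    exact not_lt.1 hk
  exact not_tendsto_atTop_of_tendsto_nhds hs.hasSum.tendsto_sum_nat hsum

/-- If the displacement is controlled by `γ a`, the sum of `γ a²` is finite and `a` is a uniformly
continuous function of the position, then `a` tends to zero as soon as it has zero as a limit
point. -/
theorem tendsto_zero_of_summable_sq {E : Type*} [PseudoMetricSpace E] {x : ℕ → E} {γ a : ℕ → ℝ}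
    (hγ : ∀ k, 0 < γ k) (hγ0 : Tendsto γ atTop (𝓝 0)) (ha : ∀ k, 0 ≤ a k)
    (hx : ∀ k, dist (x k) (x (k + 1)) ≤ γ k * a k) (hs : Summable fun k => γ k * a k ^ 2)
    (hfreq : ∀ ε > 0, ∃ᶠ k in atTop, a k < ε)
    (hunif : ∀ ε > 0, ∃ η > 0, ∀ i j, dist (x i) (x j) < η → |a i - a j| < ε) :
    Tendsto a atTop (𝓝 0) := by
  rw [Metric.tendsto_atTop]
  intro ε hε
  set δ := ε / 2 with hδdef
  have hδ : 0 < δ := half_pos hε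
  obtain ⟨η, hη, hη'⟩ := hunif δ hδ
  obtain ⟨N₁, hN₁⟩ := Metric.cauchySeq_iff.1 hs.hasSum.tendsto_sum_nat.cauchySeq (δ * (η / 2))
    (by positivity)
  have hlim : Tendsto (fun k => γ k * δ) atTop (𝓝 0) := by simpa using hγ0.mul_const δ
  obtain ⟨N₂, hN₂⟩ := eventually_atTop.1 (hlim.eventually (gt_mem_nhds (half_pos hη)))
  obtain ⟨n₀, hn₀, han₀⟩ := frequently_atTop.1 (hfreq δ hδ) (max N₁ N₂)
  refine ⟨n₀, fun m hm => ?_⟩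
  -- `k` is the last index up to `m` at which `a` is below δ.
  obtain ⟨k, hnk, hkm, hak, hbig⟩ : ∃ k, n₀ ≤ k ∧ k ≤ m ∧ a k < δ ∧
      ∀ i, k < i → i ≤ m → δ ≤ a i := by
    induction m, hm using Nat.le_induction with
    | base => exact ⟨n₀, le_rfl, le_rfl, han₀, fun i h1 h2 => absurd h1 (not_lt.2 h2)⟩
    | succ m hm ih =>
      obtain ⟨k, h1, h2, h3, h4⟩ := ih
      rcases lt_or_ge (a (m + 1)) δ with h | h
      · exact ⟨m + 1, by omega, le_rfl, h, fun i h5 h6 => absurd h5 (not_lt.2 h6)⟩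
      · refine ⟨k, h1, by omega, h3, fun i h5 h6 => ?_⟩
        rcases h6.eq_or_lt with rfl | h6
        · exact h
        · exact h4 i h5 (by omega)
  rw [Real.dist_eq, sub_zero, abs_of_nonneg (ha m)]
  rcases hkm.eq_or_lt with rfl | hkm
  · linarith
  -- The step from `k` is short because γδ < η/2. Afterwards a ≥ δ, so δ∑γa ≤ ∑γa², a Cauchy tail
  -- below δη/2.
  have hdist : dist (x k) (x m) < η := by
    have h1 := (dist_le_Ico_sum_dist x hkm.le).trans
      (Finset.sum_le_sum fun i _ => hx i)
    rw [Finset.sum_eq_sum_Ico_succ_bot hkm] at h1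
    have h2 : γ k * a k < η / 2 :=
      (mul_le_mul_of_nonneg_left hak.le (hγ k).le).trans_lt
        (hN₂ k ((le_max_right _ _).trans (hn₀.trans hnk)))
    have h3 : δ * ∑ i ∈ Finset.Ico (k + 1) m, γ i * a i ≤
        ∑ i ∈ Finset.Ico (k + 1) m, γ i * a i ^ 2 := by
      rw [Finset.mul_sum]
      refine Finset.sum_le_sum fun i hi => ?_
      rw [Finset.mem_Ico] at hi
      have h4 := mul_le_mul_of_nonneg_right (hbig i (by omega) (by omega))
        (mul_nonneg (hγ i).le (ha i))
      linarith [h4, show a i * (γ i * a i) = γ i * a i ^ 2 by ring]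
    have hN₁k : N₁ ≤ k := (le_max_left _ _).trans (hn₀.trans hnk)
    have h5 := hN₁ m (by omega) (k + 1) (by omega)
    rw [Real.dist_eq, ← Finset.sum_Ico_eq_sub _ (by omega : k + 1 ≤ m)] at h5
    have h6 := lt_of_mul_lt_mul_left ((h3.trans (le_abs_self _)).trans_lt h5) hδ.le
    linarith
  have := (abs_lt.1 (hη' k m hdist)).1
  linarith

/-! ### Descent of the penalty function -/

namespace Method

theorem inner_gradient_g_le (hP : P.Standing) (hS : S.Admissible) (hA : S.AssumptionAOn P Od Ox)
    {x d : Vec n} (hx : x ∈ P.K) (hd : d ∈ box P S.β x) (i : Fin m) :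
    inner ℝ (gradient (P.g i) x) d ≤ S.gt i d x - P.g i x := by
  have := inner_gradient_le (d := d) (b := 0) (hasGradientAt_gt hS hA hx i) fun t ht ht1 => by
    have := (convexOn_gt hP hA hx le_rfl i).2 (zero_mem_box hS.β_pos.le hx) hd
      (sub_nonneg.2 ht1.le) ht.le (by ring)
    simpa using this
  simpa [hA.A7 i x hx] using this

theorem inner_gradient_f_le (hS : S.Admissible) (hA : S.AssumptionAOn P Od Ox) {c : ℝ}
    {x d : Vec n} (hx : x ∈ P.K) (hc : StrongConvexOn Od c fun d => S.ft d x)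
    (hd : d ∈ box P S.β x) :
    inner ℝ (gradient P.f x) d ≤ S.ft d x - S.ft 0 x - c / 2 * ‖d‖ ^ 2 := by
  refine inner_gradient_le (hasGradientAt_ft hS hA hx) fun t ht ht1 => ?_
  have := hc.2 (zero_mem_Od hS hA) (hA.ball_subset hd.1) (sub_nonneg.2 ht1.le) ht.le (by ring)
  simp only [smul_zero, zero_add, smul_eq_mul, zero_sub, norm_neg] at this
  linarith

/-- The violation decreases along the direction of the subproblem, to first order. -/
theorem exists_phi_descent (hP : P.Standing) (hS : S.Admissible) (hA : S.AssumptionAOn P Od Ox)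
    {T : Set (Vec n)} (hTK : T ⊆ P.K) (hT : IsCompact T) (hTc : Convex ℝ T) :
    ∃ L : ℝ, ∀ x ∈ T, x + S.dir P x ∈ T → ∀ t : ℝ, 0 ≤ t → t ≤ 1 →
      P.phi (x + t • S.dir P x) ≤
        P.phi x - t * (S.lam * S.drop P x) + L * t ^ 2 * ‖S.dir P x‖ ^ 2 := by
  choose Lg hLg0 hLg using fun i => (hP.g_C11 i).exists_descent hTK hT hTc
  choose Lh hLh0 hLh using fun j => (hP.h_C11 j).exists_descent hTK hT hTc
  have hLgs : 0 ≤ ∑ i, Lg i := Finset.sum_nonneg fun i _ => hLg0 i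
  have hLhs : 0 ≤ ∑ j, Lh j := Finset.sum_nonneg fun j _ => hLh0 j
  refine ⟨∑ i, Lg i + ∑ j, Lh j, fun x hxT hxd t ht ht1 => ?_⟩
  have hx := hTK hxT
  have hy := hTc.add_smul_mem hxT hxd ⟨ht, ht1⟩
  set d := S.dir P x with hd
  have hdb : d ∈ box P S.β x := dir_mem_box hP hS hA hx
  have hκ := modelViolation_dir_le hP hS hA hx
  rw [kappa_eq, ← hd] at hκ
  have hκ0 : 0 ≤ P.phi x - S.lam * S.drop P x := by
    rw [← kappa_eq]; exact kappa_nonneg hP hS hA hx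
  have hnorm : ‖x + t • d - x‖ ^ 2 = t ^ 2 * ‖d‖ ^ 2 := by
    rw [add_sub_cancel_left, norm_smul, mul_pow, Real.norm_of_nonneg ht]
  have hsq : 0 ≤ t ^ 2 * ‖d‖ ^ 2 := by positivity
  have hφ := P.phi_nonneg x
  have h1t := sub_nonneg.2 ht1
  -- Each constraint at the new point is bounded by (1 - t)φ + tκ plus a quadratic remainder; the
  -- sum of all remainder constants serves every index.
  rw [Problem.phi, violation_le_iff (by nlinarith)]
  refine ⟨fun i => ?_, fun j => ?_⟩
  · have h1 := (abs_le.1 (hLg i x hxT _ hy)).2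
    rw [hnorm, add_sub_cancel_left, inner_smul_right] at h1
    have h2 := mul_le_mul_of_nonneg_left (inner_gradient_g_le hP hS hA hx hdb i) ht
    have h3 := mul_le_mul_of_nonneg_left ((gt_le_modelViolation i d x).trans hκ) ht
    have h4 := mul_le_mul_of_nonneg_left (P.g_le_phi i x) h1t
    have h5 : Lg i ≤ ∑ i, Lg i + ∑ j, Lh j := by
      have := Finset.single_le_sum (fun i _ => hLg0 i) (Finset.mem_univ i)
      linarith
    have h6 := mul_le_mul_of_nonneg_right h5 hsq
    linarith
  · have h1 := hLh j x hxT _ hy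
    rw [hnorm, add_sub_cancel_left, inner_smul_right] at h1
    have h2 : |t * P.ht j d x| ≤ t * (P.phi x - S.lam * S.drop P x) := by
      rw [abs_mul, abs_of_nonneg ht]
      exact mul_le_mul_of_nonneg_left ((abs_ht_le_modelViolation j d x).trans hκ) ht
    have h4 : |(1 - t) * P.h j x| ≤ (1 - t) * P.phi x := by
      rw [abs_mul, abs_of_nonneg h1t]
      exact mul_le_mul_of_nonneg_left (P.abs_h_le_phi j x) h1t
    have h5 : Lh j ≤ ∑ i, Lg i + ∑ j, Lh j := by
      have := Finset.single_le_sum (fun j _ => hLh0 j) (Finset.mem_univ j)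
      linarith
    have h6 := mul_le_mul_of_nonneg_right h5 hsq
    rw [Problem.ht] at h2
    rw [abs_le] at h1 h2 h4 ⊢
    constructor <;> linarith

/-- The optimal value of the subproblem exceeds its value at the origin by at most a multiple of
the decrease of the violation. -/
theorem obj_dir_sub_le (hS : S.Admissible) (hA : S.AssumptionAOn P Od Ox)
    {x : Vec n} (hx : x ∈ P.K) {ω w : ℝ} {ξ : Fin m → ℝ} {π : Fin p → ℝ} (hω : 0 < ω)
    (hw : ω ≤ w) (h : S.IsMultiplier P x w ξ π) :
    S.obj P (S.dir P x) x - S.obj P 0 x ≤ ω⁻¹ * (S.lam * S.drop P x) := by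
  have hdrop : 0 ≤ S.lam * S.drop P x := mul_nonneg hS.lam_pos.le (drop_nonneg hS hA hx)
  have h1 := h.lagr_nonneg 0 (zero_mem_box hS.β_pos.le hx)
  have h2 := lagr_le (S := S) (P := P) (π := π) h.ξ_nonneg (S.kappa P x) 0 x
  have h3 : ∑ i, ξ i + ∑ j, |π j| = 1 - w := by linarith [h.sum_eq]
  rw [h3, modelViolation_zero hA hx] at h2
  rw [kappa_eq] at h1 h2
  have h4 := mul_nonneg h.w_nonneg hdrop
  -- At d = 0 the multiplier inequality gives w times the increase ≤ (1 - w)λ·drop. Replacing w by ω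
  -- needs the increase to be nonnegative.
  rcases le_total (S.obj P (S.dir P x) x - S.obj P 0 x) 0 with h5 | h5
  · exact h5.trans (by positivity)
  · rw [le_inv_mul_iff₀ hω]
    have h6 := mul_le_mul_of_nonneg_right hw h5
    linarith

/-- The weight ω⁻¹ makes the decrease of the penalty term cancel the possible increase of the model
objective. What remains is the strong convexity gain `c / 2` and the quadratic remainders. -/
theorem exists_merit_descent (hP : P.Standing) (hS : S.Admissible)
    (hA : S.AssumptionAOn P Od Ox) {T : Set (Vec n)} (hTK : T ⊆ P.K) (hT : IsCompact T)
    (hTc : Convex ℝ T) (hCQ : ∀ x ∈ T, P.EMFCQ x) :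
    ∃ a c C : ℝ, 0 < c ∧ ∀ x ∈ T, x + S.dir P x ∈ T → ∀ t : ℝ, 0 ≤ t → t ≤ 1 →
      P.merit a (x + t • S.dir P x) ≤
        P.merit a x - t * c * ‖S.dir P x‖ ^ 2 + C * t ^ 2 * ‖S.dir P x‖ ^ 2 := by
  obtain ⟨L, hL⟩ := exists_phi_descent hP hS hA hTK hT hTc
  obtain ⟨Lf, -, hLf⟩ := hP.f_C11.exists_descent hTK hT hTc
  obtain ⟨ω, hω, hmul⟩ := exists_isMultiplier_ge hP hS hA hTK hT hCQ
  obtain ⟨c, hc, hsc⟩ := hA.A1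
  refine ⟨ω⁻¹, c / 2, Lf + ω⁻¹ * L, half_pos hc, fun x hxT hxd t ht ht1 => ?_⟩
  have hx := hTK hxT
  obtain ⟨w, ξ, π, hw, hm⟩ := hmul x hxT
  have hdb := dir_mem_box hP hS hA hx
  have h1 := mul_le_mul_of_nonneg_left (hL x hxT hxd t ht ht1) (inv_pos.2 hω).le
  have h2 := mul_le_mul_of_nonneg_left (obj_dir_sub_le hS hA hx hω hw hm) ht
  have h3 := mul_le_mul_of_nonneg_left (inner_gradient_f_le hS hA hx (hsc x hx) hdb) ht
  have h4 := (abs_le.1 (hLf x hxT _ (hTc.add_smul_mem hxT hxd ⟨ht, ht1⟩))).2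
  rw [add_sub_cancel_left, inner_smul_right, norm_smul, mul_pow, Real.norm_of_nonneg ht] at h4
  have h5 := hP.q_convex.2 hx (hTK hxd) (sub_nonneg.2 ht1) ht (by ring)
  have h6 : (1 - t) • x + t • (x + S.dir P x) = x + t • S.dir P x := by module
  rw [h6, smul_eq_mul, smul_eq_mul] at h5
  simp only [obj, add_zero] at h2
  simp only [Problem.merit]
  linarith

/-! ### Runs of the algorithm -/

theorem isKKT_of_isStationary {x : Vec n} (h : P.IsStationary x) (hCQ : ∀ y ∈ P.K, P.EMFCQ y) :
    P.IsKKT x := by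
  rcases h with h | h | h
  · exact h
  · exact absurd (hCQ x h.1) h.2.2
  · exact absurd (hCQ x h.1) h.2.2

theorem Generates.mem (hP : P.Standing) (hS : S.Admissible) (hA : S.AssumptionAOn P Od Ox)
    {γ : ℕ → ℝ} (hγ : IsStepsize γ) {x : ℕ → Vec n} (hx : S.Generates P γ x) (k : ℕ) :
    x k ∈ P.K := by
  induction k with
  | zero => exact hx.start
  | succ k ih =>
    by_cases h : P.IsStationary (x k)
    · rw [hx.halt k h]; exact ih
    · rw [hx.step k h]
      exact hP.K_convex.add_smul_mem ih (dir_mem_box hP hS hA ih).2 ⟨(hγ.pos k).le, hγ.le_one k⟩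

theorem Generates.eq_of_isStationary {γ : ℕ → ℝ} {x : ℕ → Vec n} (hx : S.Generates P γ x) {k : ℕ}
    (hk : P.IsStationary (x k)) {l : ℕ} (hl : k ≤ l) : x l = x k := by
  induction l, hl using Nat.le_induction with
  | base => rfl
  | succ l _ ih => rw [hx.halt l (by rwa [ih]), ih]

/-- A compact convex subset of `K` on which a bounded run takes place. -/
theorem exists_compact_convex (hP : P.Standing) (hS : S.Admissible)
    (hA : S.AssumptionAOn P Od Ox) {x : ℕ → Vec n} (hxK : ∀ k, x k ∈ P.K)
    (hbdd : Bornology.IsBounded (Set.range x)) :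
    ∃ T ⊆ P.K, IsCompact T ∧ Convex ℝ T ∧ (∀ k, x k ∈ T) ∧ ∀ k, x k + S.dir P (x k) ∈ T := by
  -- The ball must hold the iterates and also the full steps x + d(x), so that the segments used in
  -- the descent estimates stay in `T`.
  obtain ⟨R, hR⟩ := (hbdd.union (hbdd.add (isCompact_infBall n S.β).isBounded)).subset_closedBall 0
  refine ⟨P.K ∩ Metric.closedBall 0 R, inter_subset_left,
    (isCompact_closedBall 0 R).inter_left hP.K_closed, hP.K_convex.inter (convex_closedBall 0 R),
    fun k => ⟨hxK k, hR (Or.inl ⟨k, rfl⟩)⟩, fun k => ?_⟩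
  have hd := dir_mem_box hP hS hA (hxK k)
  exact ⟨hd.2, hR (Or.inr (Set.add_mem_add ⟨k, rfl⟩ hd.1))⟩

/-- Convergence of bounded runs that never stop. -/
theorem convergence_of_not_isStationary (hP : P.Standing) (hS : S.Admissible)
    (hA : S.AssumptionAOn P Od Ox) (hCQ : ∀ y ∈ P.K, P.EMFCQ y) {γ : ℕ → ℝ} (hγ : IsStepsize γ)
    {x : ℕ → Vec n} (hx : S.Generates P γ x) (hbdd : Bornology.IsBounded (Set.range x))
    (hns : ∀ k, ¬ P.IsStationary (x k)) :
    (∃ xhat, MapClusterPt xhat atTop x ∧ P.IsKKT xhat) ∧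
      (S.AssumptionB P → ∀ xhat, MapClusterPt xhat atTop x → P.IsKKT xhat) := by
  have hxK := hx.mem hP hS hA hγ
  obtain ⟨T, hTK, hT, hTc, hxT, hxdT⟩ := exists_compact_convex hP hS hA hxK hbdd
  have hCQT : ∀ y ∈ T, P.EMFCQ y := fun y hy => hCQ y (hTK hy)
  obtain ⟨a, c, C, hc, hdesc⟩ := exists_merit_descent hP hS hA hTK hT hTc hCQT
  have hmcont : ContinuousOn (P.merit a) T :=
    ((hP.f_C11.continuousOn.add (P.continuousOn_q hP)).add
      ((P.continuousOn_phi hP).const_smul a)).mono hTK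
  obtain ⟨M, hM⟩ := hT.exists_bound_of_continuousOn hmcont
  have hsum : Summable fun k => γ k * ‖S.dir P (x k)‖ ^ 2 := by
    refine summable_of_descent (W := fun k => P.merit a (x k)) hγ.pos hγ.tendsto_zero
      (fun k => by positivity) hc (fun k => (abs_le.1 (hM _ (hxT k))).1) (C := C) fun k => ?_
    rw [hx.step k (hns k)]
    exact hdesc _ (hxT k) (hxdT k) _ (hγ.pos k).le (hγ.le_one k)
  have hfreq : ∀ ε > 0, ∃ᶠ k in atTop, ‖S.dir P (x k)‖ < ε := fun ε hε =>
    (frequently_lt_of_summable hγ.pos hγ.sum_infinite hsum (sq_pos_of_pos hε)).mono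
      fun k hk => lt_of_pow_lt_pow_left₀ 2 hε.le hk
  refine ⟨?_, fun hB xhat hxhat => ?_⟩
  · obtain ⟨s, hs, hsdir⟩ := extraction_forall_of_frequently
      fun k : ℕ => hfreq (1 / ((k : ℝ) + 1)) (by positivity)
    have hdir : Tendsto (fun k => S.dir P (x (s k))) atTop (𝓝 0) :=
      squeeze_zero_norm (fun k => (hsdir k).le) tendsto_one_div_add_atTop_nhds_zero_nat
    obtain ⟨xhat, -, r, hr, hlim⟩ := hT.tendsto_subseq fun k => hxT (s k)
    exact ⟨xhat, hlim.mapClusterPt.of_comp (hs.comp hr).tendsto_atTop,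
      isKKT_of_tendsto hP hS hA hTK hT hCQT (fun k => hxT (s (r k))) hlim
        (hdir.comp hr.tendsto_atTop)⟩
  · obtain ⟨μ, α, hμ, hα, hhold⟩ := hB T hTK hT
    have hdir : Tendsto (fun k => ‖S.dir P (x k)‖) atTop (𝓝 0) := by
      refine tendsto_zero_of_summable_sq (x := x) hγ.pos hγ.tendsto_zero
        (fun k => norm_nonneg _) (fun k => ?_) hsum hfreq fun ε hε => ?_
      · rw [hx.step k (hns k), dist_self_add_right, norm_smul, Real.norm_of_nonneg (hγ.pos k).le]
      · have hcont : Tendsto (fun t : ℝ => μ * t ^ α) (𝓝 0) (𝓝 0) := by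
          have := ((Real.continuousAt_rpow_const 0 α (Or.inr hα.le)).tendsto).const_mul μ
          rwa [Real.zero_rpow hα.ne', mul_zero] at this
        obtain ⟨η, hη, hη'⟩ := Metric.eventually_nhds_iff.1 (hcont.eventually (gt_mem_nhds hε))
        refine ⟨η, hη, fun i j hij => (abs_norm_sub_norm_le _ _).trans_lt
          ((hhold _ (hxT i) _ (hxT j)).trans_lt (hη' ?_))⟩
        rwa [Real.dist_eq, sub_zero, abs_of_nonneg (norm_nonneg _), ← dist_eq_norm]
    obtain ⟨s, hs, hlim⟩ := hxhat.tendsto_subseq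
    exact isKKT_of_tendsto hP hS hA hTK hT hCQT (fun k => hxT (s k)) hlim
      ((tendsto_zero_iff_norm_tendsto_zero.2 hdir).comp hs.tendsto_atTop)

end Method

end GhostPenalty

theorem corollary1 {n m p : ℕ} (P : GhostPenalty.Problem n m p) (hP : P.Standing)
    (S : GhostPenalty.Method n m) (hS : S.Admissible) (hA : S.AssumptionA P)
    (hCQ : ∀ y ∈ P.K, P.EMFCQ y)
    (γ : ℕ → ℝ) (hγ : GhostPenalty.Method.IsStepsize γ)
    (x : ℕ → GhostPenalty.Vec n) (hx : S.Generates P γ x) :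
    (∀ ν, x ν ∈ P.K) ∧
      (¬ Bornology.IsBounded (Set.range x) ∨
        ((∃ xhat, MapClusterPt xhat atTop x ∧ P.IsKKT xhat) ∧
          (S.AssumptionB P → ∀ xhat, MapClusterPt xhat atTop x → P.IsKKT xhat))) := by
  obtain ⟨Od, Ox, hA⟩ := hA
  refine ⟨hx.mem hP hS hA hγ, or_iff_not_imp_left.2 fun hbdd => ?_⟩
  -- A halted run is eventually constant, so its only limit point is the returned point, which the
  -- eMFCQ forces to be a KKT point.
  by_cases hhalt : ∃ k, P.IsStationary (x k)
  · obtain ⟨k, hk⟩ := hhalt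
    have hKKT := GhostPenalty.Method.isKKT_of_isStationary hk hCQ
    have hlim : Tendsto x atTop (𝓝 (x k)) := tendsto_const_nhds.congr' (by
      filter_upwards [eventually_ge_atTop k] with l hl
      exact (hx.eq_of_isStationary hk hl).symm)
    refine ⟨⟨x k, hlim.mapClusterPt, hKKT⟩, fun _ xhat hxhat => ?_⟩
    obtain ⟨s, hs, hs'⟩ := hxhat.tendsto_subseq
    rwa [tendsto_nhds_unique hs' (hlim.comp hs.tendsto_atTop)]
  · exact GhostPenalty.Method.convergence_of_not_isStationary hP hS hA hCQ hγ hx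
      (not_not.1 hbdd) (not_exists.1 hhalt)
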